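/- Let $n\ge 1$ and let $\Gamma$ be a connected simple graph on the vertex set $[n]=\{1,\dots,n\}$. Write $w(i,j)$ for the product of $w\in S_n$ with the transposition $(i,j)$ on the right. The ring of splines of $\Gamma$ is $$\mathcal S_\Gamma=\bigl\{\bar\rho: S_n\to\mathbb C[t_1,\dots,t_n]\ \bigm|\ \bar\rho(w)-\bar\rho(w(i,j))\in\langle t_{w(i)}-t_{w(j)}\rangle\ \text{for all } w\in S_n,\ (i,j)\in E(\Gamma)\bigr\},$$ and $\mathcal S_\Gamma^1$ is the $\mathbb C$-vector space of those splines all of whose values are zero or homogeneous of degree $1$. A vertex $v$ is a *cut vertex* if $\Gamma-v$ (the induced subgraph on the other vertices) is disconnected; an edge is a *cut edge* if deleting it, but no vertex, disconnects $\Gamma$. Let $\mathcal F_\Gamma$ be the set of the following functions on $S_n$: - $\bar t_i(w)=t_i$ and $\bar x_i(w)=t_{w(i)}$, for $i\in[n]$; - for each cut edge $s=(i,j)$ with $i<j$ and each $A\subseteq[n]$ with $|A|=|G_s|$, where $G_s$ is the component containing $i$ of $([n],E(\Gamma)\setminus\{s\})$: $\bar f_A^s(w)=t_{w(i)}-t_{w(j)}$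 if $w^{-1}(A)=V(G_s)$, and $0$ otherwise; - for each cut vertex $j$, each connected component $G$ of $\Gamma-j$ and each $k\in[n]$: $\bar y^j_{G,k}(w)=t_k-t_{w(j)}$ if $w^{-1}(k)\in G$, and $0$ otherwise. **(1)** The $\mathbb C$-linear span of $\mathcal F_\Gamma$ is $\mathcal S_\Gamma^1$. For (2) we use the following notions. $\Gamma$ is *cliqued* if any two distinct vertices joined by two different paths with no common vertices except the end points are adjacent. A *block* is a maximal subgraph that is connected and stays connected when any one of its vertices is removed (a single edge may be a block). The *block-cut tree* has as vertices the cut vertices and the blocks of $\Gamma$, with a cut vertex $v$ joined to a block $B$ when $v\in B$. $\Gamma$ is *naturally labelled* if there are a cut vertex $v$ lying in at most one block that is not a leaf of the block-cut tree, and a block $B$ of largest size among the leaves of the block-cut tree that are adjacent to $v$, such that $V(B)=\{n-|B|+1,\dots,n\}$, $v=n-|B|+1\ne n$, and, whenever $j,k$ are both in $V(B)\setminus\{n,v\}$ or both outside $V(B)$, $d(j,n)<d(k,n)$ implies $j>k$ (with $d$ the graph distance in $\Gamma$). A pair $(i,j)$ with $i<j$ is *dominant* if $j$ is a cut vertex and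 $i$ is the largest vertex of a connected component of $\Gamma-j$ not containing $n$; this component is denoted $\Gamma_i^j$. It is *strongly dominant* if $(i,j)$ is a cut edge and *weakly dominant* otherwise. $\Gamma$ is of - *type A* if $(n-1,n)$ is a cut edge and at most one component of $\Gamma-(n-1)$ is not an isolated vertex; - *type B* if $n-2$ is a cut vertex and $\{n-2,n-1,n\}$ is the vertex set of a block; - *type C* if none of $n-2,n-1,n$ is a cut vertex and these three vertices form a clique. **(2)** If $\Gamma$ is moreover cliqued and naturally labelled, then it is of type A, B or C, and $$\dim_{\mathbb C}\mathcal S_\Gamma^1=1+\dim_{\mathbb C}\mathcal S_{\Gamma-n}^1+\epsilon+\sum_{(i,j)\text{ strongly dominant}}\binom{n-1}{|\Gamma_i^j|-1}+\#\{(i,j)\text{ weakly dominant}\},$$ where $\epsilon=\binom{n-1}{1}$ if $\Gamma$ is of type A and $\epsilon=1$ if $\Gamma$ is of type B or C. Here $\Gamma-n$ is regarded as a graph on $[n-1]$. -/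

import Mathlib

noncomputable section

namespace CayleySplines

open SimpleGraph

/-! ### Graph notions -/

section Graphs

/-- `v` is a cut vertex of `Γ`: the graph `Γ - v` is disconnected. -/
def IsCutVertex {V : Type*} (Γ : SimpleGraph V) (v : V) : Prop :=
  ¬ (Γ.induce {v}ᶜ).Preconnected

/-- `(i, j)` is a cut edge of `Γ`: it is an edge, and removing it (but no vertex) disconnects
the graph. -/
def IsCutEdge {V : Type*} (Γ : SimpleGraph V) (i j : V) : Prop :=
  Γ.Adj i j ∧ ¬ (Γ.deleteEdges {s(i, j)}).Preconnected

/-- `G` is the vertex set of a connected component of `Γ - j`. -/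
def IsComponentOfDelete {V : Type*} (Γ : SimpleGraph V) (j : V) (G : Set V) : Prop :=
  ∃ C : (Γ.induce {j}ᶜ).ConnectedComponent, G = Subtype.val '' C.supp

/-- The vertex set of the connected component of `Γ - j` that contains `i` (for `i ≠ j`). -/
def componentOfDelete {V : Type*} (Γ : SimpleGraph V) (j i : V) : Set V :=
  {k | ∃ (hi : i ∈ ({j}ᶜ : Set V)) (hk : k ∈ ({j}ᶜ : Set V)),
    (Γ.induce {j}ᶜ).Reachable ⟨i, hi⟩ ⟨k, hk⟩}

/-- The vertex set of the component containing `i` of the graph `Γ` with the edge `(i, j)`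
removed. -/
def cutEdgeComponent {V : Type*} (Γ : SimpleGraph V) (i j : V) : Set V :=
  {k | (Γ.deleteEdges {s(i, j)}).Reachable i k}

/-- A graph is 2-connected if it is connected and remains connected after removing any one
vertex. (A single edge is 2-connected in this sense.) -/
def IsTwoConnected {V : Type*} (Γ : SimpleGraph V) : Prop :=
  Γ.Connected ∧ ∀ v : V, (Γ.induce {v}ᶜ).Preconnected

/-- `B` is the vertex set of a block of `Γ`, i.e. of a maximal 2-connected subgraph. Such a subgraph
is induced, so blocks are identified with their vertex sets. -/
def IsBlock {V : Type*} (Γ : SimpleGraph V) (B : Set V) : Prop :=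
  Maximal (fun s : Set V => IsTwoConnected (Γ.induce s)) B

/-- The block-cut tree: its vertices are the cut vertices and the blocks of `Γ`, and a cut vertex
`v` is joined to a block `B` when `v ∈ B`. -/
def blockCutTree {V : Type*} (Γ : SimpleGraph V) :
    SimpleGraph ({v : V // IsCutVertex Γ v} ⊕ {B : Set V // IsBlock Γ B}) :=
  SimpleGraph.fromRel fun x y =>
    ∃ (v : {v : V // IsCutVertex Γ v}) (B : {B : Set V // IsBlock Γ B}),
      x = Sum.inl v ∧ y = Sum.inr B ∧ (v : V) ∈ (B : Set V)

/-- `B` is a leaf of the block-cut tree. -/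
def IsLeafBlock {V : Type*} (Γ : SimpleGraph V) (B : {B : Set V // IsBlock Γ B}) : Prop :=
  ((blockCutTree Γ).neighborSet (Sum.inr B)).ncard = 1

/-- `Γ` is cliqued: two vertices are adjacent as soon as they are joined by two (different) paths
that share no vertices except their end points. -/
def IsCliqued {V : Type*} (Γ : SimpleGraph V) : Prop :=
  ∀ i j : V, i ≠ j →
    (∃ p q : Γ.Path i j, p ≠ q ∧
      ∀ x, x ∈ (p : Γ.Walk i j).support → x ∈ (q : Γ.Walk i j).support → x = i ∨ x = j) →
    Γ.Adj i j

end Graphs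

/-! ### Labelled graphs

The vertex set `{1, …, n}` with `n = m + 1` is `Fin (m + 1)`; the label `k` is the element with
value `k - 1`, so that the label `n` is `Fin.last m`. -/

section Labelled

/-- `Γ` is naturally labelled. There are a cut vertex `v` lying in at most one non-leaf block and a
largest leaf block `B` at `v`, such that: `n ∈ B` and `n ≠ v`; the vertices of `B` carry the
largest `|B|` labels, and `v` carries the smallest of these (`B = {v, v + 1, …, n}`); and
vertices closer to `n` have larger labels, separately among the vertices of `B` other than
`n` and `v`, and among the vertices outside `B`. -/
def IsNaturallyLabelled {m : ℕ} (Γ : SimpleGraph (Fin (m + 1))) : Prop :=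
  ∃ (v : {v : Fin (m + 1) // IsCutVertex Γ v}) (B : {B : Set (Fin (m + 1)) // IsBlock Γ B}),
    {B' : {B : Set (Fin (m + 1)) // IsBlock Γ B} |
      (blockCutTree Γ).Adj (Sum.inl v) (Sum.inr B') ∧ ¬ IsLeafBlock Γ B'}.Subsingleton ∧
    (blockCutTree Γ).Adj (Sum.inl v) (Sum.inr B) ∧ IsLeafBlock Γ B ∧
    (∀ B' : {B : Set (Fin (m + 1)) // IsBlock Γ B},
      (blockCutTree Γ).Adj (Sum.inl v) (Sum.inr B') → IsLeafBlock Γ B' →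
        (B' : Set (Fin (m + 1))).ncard ≤ (B : Set (Fin (m + 1))).ncard) ∧
    Fin.last m ∈ (B : Set (Fin (m + 1))) ∧ Fin.last m ≠ v ∧
    (B : Set (Fin (m + 1))) = Set.Ici (v : Fin (m + 1)) ∧
    (∀ j ∈ (B : Set (Fin (m + 1))) \ {Fin.last m, (v : Fin (m + 1))},
      ∀ k ∈ (B : Set (Fin (m + 1))) \ {Fin.last m, (v : Fin (m + 1))},
        Γ.dist j (Fin.last m) < Γ.dist k (Fin.last m) → k < j) ∧
    (∀ j ∉ (B : Set (Fin (m + 1))), ∀ k ∉ (B : Set (Fin (m + 1))),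
        Γ.dist j (Fin.last m) < Γ.dist k (Fin.last m) → k < j)

/-- `(i, j)` is a dominant pair: `j` is a cut vertex, `i < j`, and `i` is the largest vertex of a
connected component of `Γ - j` that does not contain `n`. -/
def IsDominantPair {m : ℕ} (Γ : SimpleGraph (Fin (m + 1))) (i j : Fin (m + 1)) : Prop :=
  IsCutVertex Γ j ∧ i < j ∧
    ∃ G : Set (Fin (m + 1)), IsComponentOfDelete Γ j G ∧ Fin.last m ∉ G ∧ IsGreatest G i

/-- A dominant pair is strongly dominant if it is a cut edge. -/
def IsStronglyDominant {m : ℕ} (Γ : SimpleGraph (Fin (m + 1))) (i j : Fin (m + 1)) : Prop :=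
  IsDominantPair Γ i j ∧ IsCutEdge Γ i j

/-- A dominant pair is weakly dominant if it is not strongly dominant. -/
def IsWeaklyDominant {m : ℕ} (Γ : SimpleGraph (Fin (m + 1))) (i j : Fin (m + 1)) : Prop :=
  IsDominantPair Γ i j ∧ ¬ IsCutEdge Γ i j

/-- Type A: `(n - 1, n)` is a cut edge, and at most one component of `Γ - (n - 1)` is not an
isolated vertex. -/
def IsTypeA {m : ℕ} (Γ : SimpleGraph (Fin (m + 1))) : Prop :=
  ∃ a : Fin (m + 1), (a : ℕ) + 1 = m ∧ IsCutEdge Γ a (Fin.last m) ∧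
    {G : Set (Fin (m + 1)) | IsComponentOfDelete Γ a G ∧ G.ncard ≠ 1}.Subsingleton

/-- Type B: `n - 2` is a cut vertex, and `{n - 2, n - 1, n}` is a block. -/
def IsTypeB {m : ℕ} (Γ : SimpleGraph (Fin (m + 1))) : Prop :=
  ∃ a b : Fin (m + 1), (a : ℕ) + 2 = m ∧ (b : ℕ) + 1 = m ∧
    IsCutVertex Γ a ∧ IsBlock Γ {a, b, Fin.last m}

/-- Type C: none of `n - 2`, `n - 1`, `n` is a cut vertex, and these vertices form a clique. -/
def IsTypeC {m : ℕ} (Γ : SimpleGraph (Fin (m + 1))) : Prop :=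
  ∃ a b : Fin (m + 1), (a : ℕ) + 2 = m ∧ (b : ℕ) + 1 = m ∧
    ¬ IsCutVertex Γ a ∧ ¬ IsCutVertex Γ b ∧ ¬ IsCutVertex Γ (Fin.last m) ∧
    Γ.IsClique {a, b, Fin.last m}

/-- The induced subgraph `Γ - n`, as a graph on `{1, …, n - 1}`. -/
def deleteLast {m : ℕ} (Γ : SimpleGraph (Fin (m + 1))) : SimpleGraph (Fin m) :=
  Γ.comap Fin.castSucc

end Labelled

/-! ### Splines -/

section Splines

open MvPolynomial

/-- The ring of splines on the Cayley graph of `S_n` with generators the edges of `Γ`. It consists of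
the functions `ρ : S_n → ℂ[t_1, …, t_n]` such that `ρ(w) - ρ(w (i, j))` lies in the ideal
`⟨t_{w(i)} - t_{w(j)}⟩` for every permutation `w` and every edge `(i, j)` of `Γ`. -/
def splines {n : ℕ} (Γ : SimpleGraph (Fin n)) :
    Subalgebra ℂ (Equiv.Perm (Fin n) → MvPolynomial (Fin n) ℂ) where
  carrier := {ρ | ∀ (w : Equiv.Perm (Fin n)) (i j : Fin n), Γ.Adj i j →
    ρ w - ρ (w * Equiv.swap i j) ∈
      Ideal.span {(X (w i) - X (w j) : MvPolynomial (Fin n) ℂ)}}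
  add_mem' := by
    intro a b ha hb w i j h
    have := Ideal.add_mem _ (ha w i j h) (hb w i j h)
    simpa only [Pi.add_apply, add_sub_add_comm] using this
  mul_mem' := by
    intro a b ha hb w i j h
    have := Ideal.add_mem _ (Ideal.mul_mem_left _ (a w) (hb w i j h))
      (Ideal.mul_mem_left _ (b (w * Equiv.swap i j)) (ha w i j h))
    convert this using 1
    simp only [Pi.mul_apply]
    ring
  algebraMap_mem' := by
    intro r w i j _
    simp [Pi.algebraMap_apply]

/-- The degree `d` graded piece of the ring of splines, a `ℂ`-vector space. -/
def splinesOfDegree {n : ℕ} (Γ : SimpleGraph (Fin n)) (d : ℕ) :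
    Submodule ℂ (Equiv.Perm (Fin n) → MvPolynomial (Fin n) ℂ) :=
  Subalgebra.toSubmodule (splines Γ) ⊓
    Submodule.pi Set.univ (fun _ => homogeneousSubmodule (Fin n) ℂ d)

/-- The spline `t̄_i`, with `t̄_i(w) = t_i`. -/
def tBar {n : ℕ} (i : Fin n) : Equiv.Perm (Fin n) → MvPolynomial (Fin n) ℂ :=
  fun _ => X i

/-- The spline `x̄_i`, with `x̄_i(w) = t_{w(i)}`. -/
def xBar {n : ℕ} (i : Fin n) : Equiv.Perm (Fin n) → MvPolynomial (Fin n) ℂ :=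
  fun w => X (w i)

open Classical in
/-- The linear coset spline of the cut edge `s = (i, j)` and the set `A`: its value at `w` is
`t_{w(i)} - t_{w(j)}` if `w⁻¹(A) = V(G_s)`, and `0` otherwise. Here `G_s` is the component
containing `i` of the graph `Γ` with `s` removed. -/
def fBar {n : ℕ} (Γ : SimpleGraph (Fin n)) (i j : Fin n) (A : Set (Fin n)) :
    Equiv.Perm (Fin n) → MvPolynomial (Fin n) ℂ :=
  fun w => if w ⁻¹' A = cutEdgeComponent Γ i j then X (w i) - X (w j) else 0

open Classical in
/-- The spline `ȳ^j_{G,k}`: its value at `w` is `t_k - t_{w(j)}` if `w⁻¹(k) ∈ G`, and `0`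
otherwise. -/
def yBar {n : ℕ} (j : Fin n) (G : Set (Fin n)) (k : Fin n) :
    Equiv.Perm (Fin n) → MvPolynomial (Fin n) ℂ :=
  fun w => if w⁻¹ k ∈ G then X k - X (w j) else 0

/-- The linear coset splines attached to the cut edges `(i, j)`, `i < j`, of `Γ`. -/
def cosetSplines {n : ℕ} (Γ : SimpleGraph (Fin n)) :
    Set (Equiv.Perm (Fin n) → MvPolynomial (Fin n) ℂ) :=
  {ρ | ∃ (i j : Fin n) (A : Set (Fin n)), i < j ∧ IsCutEdge Γ i j ∧
    A.ncard = (cutEdgeComponent Γ i j).ncard ∧ ρ = fBar Γ i j A}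

/-- The splines `ȳ^j_{G,k}` attached to the cut vertices `j` of `Γ`, the components `G` of
`Γ - j`, and the indices `k`. -/
def cutVertexSplines {n : ℕ} (Γ : SimpleGraph (Fin n)) :
    Set (Equiv.Perm (Fin n) → MvPolynomial (Fin n) ℂ) :=
  {ρ | ∃ (j : Fin n) (G : Set (Fin n)) (k : Fin n), IsCutVertex Γ j ∧
    IsComponentOfDelete Γ j G ∧ ρ = yBar j G k}

/-- The set `F_Γ`. -/
def linearGenerators {n : ℕ} (Γ : SimpleGraph (Fin n)) :
    Set (Equiv.Perm (Fin n) → MvPolynomial (Fin n) ℂ) :=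
  Set.range tBar ∪ Set.range xBar ∪ cosetSplines Γ ∪ cutVertexSplines Γ

/-- `Σ C(n - 1, |Γ_i^j| - 1)` over the strongly dominant pairs `(i, j)`, where `n = m + 1` and
`Γ_i^j` is the component of `Γ - j` containing `i`. -/
def strongTerm {m : ℕ} (Γ : SimpleGraph (Fin (m + 1))) : ℕ :=
  ∑ᶠ p ∈ {p : Fin (m + 1) × Fin (m + 1) | IsStronglyDominant Γ p.1 p.2},
    m.choose ((componentOfDelete Γ p.2 p.1).ncard - 1)

/-- The number of weakly dominant pairs. -/
def weakTerm {m : ℕ} (Γ : SimpleGraph (Fin (m + 1))) : ℕ :=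
  {p : Fin (m + 1) × Fin (m + 1) | IsWeaklyDominant Γ p.1 p.2}.ncard

end Splines

end CayleySplines

end

/-!
Fix a root `r`. Writing the value at `w` of a linear spline in the variables `t_{w(p)}` turns the
splines into families of coordinate functions `a p` on the symmetric group, and the edge condition
at `(i, j)` says that right multiplication by the transposition `(i, j)` fixes every coordinate
other than `a i` and `a j`, and fixes their sum.

Let `S` be a component of `Γ - i` and `j ∈ S` a neighbour of `i`. The jump of `a j` across `(i, j)`
is the difference of values of a function of `w(S)` if `(i, j)` is a cut edge, and of a function of
`w(j)` otherwise; such functions also arise as jumps from the splines `f̄` and `ȳ`. Treating the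
pairs `(i, S)` with `r ∉ S` in the order of the distance of `i` from `r`, the jumps can be removed
one after the other, and a family without jumps is constant. So these splines together with the
constant families form a basis after one normalization per pair, and the dimension is
`n + ∑ (C(n, c) - 1)`, where `c` is `|S|` or `1`.

For a natural labelling take `r = n`. Then `n` lies in a clique attached to the rest of `Γ` at one
cut vertex, so the pairs `(i, S)` of `Γ` with `i ≠ n` correspond to pairs of `Γ - n`, and Pascal's
rule `C(n, c) = C(n - 1, c - 1) + C(n - 1, c)` compares their contributions. The first summands
are the terms of the dominant pairs.
-/

noncomputable section

namespace CayleySplines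

open SimpleGraph

/-! ### Deleting a vertex or an edge -/

section DeletedGraphs

variable {V : Type*} {Γ H : SimpleGraph V} {i j r v x y : V} {G : Set V}

theorem iff_of_reachable {P : V → Prop} (hP : ∀ x y, H.Adj x y → (P x ↔ P y))
    (h : H.Reachable x y) : P x ↔ P y := by
  obtain ⟨p⟩ := h
  induction p with
  | nil => rfl
  | cons hxy _ ih => exact (hP _ _ hxy).trans ih

theorem ne_of_reachable_deleteIncidenceSet (h : (Γ.deleteIncidenceSet v).Reachable x y)
    (hx : x ≠ v) : y ≠ v :=
  (iff_of_reachable (P := (· ≠ v))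
    (fun _ _ h => iff_of_true (Γ.deleteIncidenceSet_adj.1 h).2.1
      (Γ.deleteIncidenceSet_adj.1 h).2.2) h).1 hx

theorem reachable_deleteIncidenceSet_of_adj (h : Γ.Adj x y) (hx : x ≠ v) (hy : y ≠ v) :
    (Γ.deleteIncidenceSet v).Reachable x y :=
  (Γ.deleteIncidenceSet_adj.2 ⟨h, hx, hy⟩ : (Γ.deleteIncidenceSet v).Adj x y).reachable

theorem reachable_induce_compl_singleton_iff (hx : x ∈ ({v}ᶜ : Set V)) (hy : y ∈ ({v}ᶜ : Set V)) :
    (Γ.induce {v}ᶜ).Reachable ⟨x, hx⟩ ⟨y, hy⟩ ↔ (Γ.deleteIncidenceSet v).Reachable x y := by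
  rw [← Γ.induce_deleteIncidenceSet_of_notMem (by simp : v ∉ ({v}ᶜ : Set V))]
  refine ⟨fun h => h.map (Embedding.induce _).toHom, fun ⟨p⟩ => ?_⟩
  classical
  exact ⟨p.induce _ fun z hz =>
    ne_of_reachable_deleteIncidenceSet (p.takeUntil z hz).reachable hx⟩

theorem isCutVertex_iff : IsCutVertex Γ v ↔
    ∃ x y, x ≠ v ∧ y ≠ v ∧ ¬ (Γ.deleteIncidenceSet v).Reachable x y := by
  unfold IsCutVertex Preconnected
  push Not
  exact ⟨fun ⟨x, y, h⟩ => ⟨x, y, x.2, y.2, mt (reachable_induce_compl_singleton_iff x.2 y.2).2 h⟩,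
    fun ⟨x, y, hx, hy, h⟩ =>
      ⟨⟨x, hx⟩, ⟨y, hy⟩, mt (reachable_induce_compl_singleton_iff hx hy).1 h⟩⟩

theorem mem_componentOfDelete (hx : x ≠ i) :
    y ∈ componentOfDelete Γ i x ↔ (Γ.deleteIncidenceSet i).Reachable x y :=
  ⟨fun ⟨_, hy, h⟩ => (reachable_induce_compl_singleton_iff hx hy).1 h, fun h =>
    have hy := ne_of_reachable_deleteIncidenceSet h hx
    ⟨hx, hy, (reachable_induce_compl_singleton_iff hx hy).2 h⟩⟩

theorem isComponentOfDelete_iff :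
    IsComponentOfDelete Γ i G ↔ ∃ x, x ≠ i ∧ G = componentOfDelete Γ i x := by
  have himage (x : V) (hx : x ∈ ({i}ᶜ : Set V)) :
      Subtype.val '' ((Γ.induce {i}ᶜ).connectedComponentMk ⟨x, hx⟩).supp =
        componentOfDelete Γ i x := by
    ext y
    simp only [componentOfDelete, Set.mem_image, ConnectedComponent.mem_supp_iff,
      ConnectedComponent.eq, Subtype.exists, exists_and_right, exists_eq_right, Set.mem_ofPred_eq,
      exists_prop_of_true hx, reachable_comm]
  constructor
  · rintro ⟨C, rfl⟩
    induction C using ConnectedComponent.ind with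
    | h x => exact ⟨x, x.2, himage x x.2⟩
  · rintro ⟨x, hx, rfl⟩
    exact ⟨_, (himage x hx).symm⟩

theorem isComponentOfDelete_componentOfDelete (hx : x ≠ i) :
    IsComponentOfDelete Γ i (componentOfDelete Γ i x) :=
  isComponentOfDelete_iff.2 ⟨x, hx, rfl⟩

theorem self_mem_componentOfDelete (hx : x ≠ i) : x ∈ componentOfDelete Γ i x :=
  (mem_componentOfDelete hx).2 (Reachable.refl x)

namespace IsComponentOfDelete

theorem notMem (h : IsComponentOfDelete Γ i G) : i ∉ G := by
  obtain ⟨x, -, rfl⟩ := isComponentOfDelete_iff.1 h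
  exact fun ⟨_, hi, _⟩ => hi rfl

theorem ne_of_mem (h : IsComponentOfDelete Γ i G) (hx : x ∈ G) : x ≠ i :=
  fun e => h.notMem (e ▸ hx)

theorem mem_iff (h : IsComponentOfDelete Γ i G) (hx : x ∈ G) :
    y ∈ G ↔ (Γ.deleteIncidenceSet i).Reachable x y := by
  obtain ⟨z, hz, rfl⟩ := isComponentOfDelete_iff.1 h
  rw [mem_componentOfDelete hz] at hx ⊢
  exact ⟨hx.symm.trans, hx.trans⟩

theorem eq_componentOfDelete (h : IsComponentOfDelete Γ i G) (hx : x ∈ G) :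
    G = componentOfDelete Γ i x :=
  Set.ext fun _ => (h.mem_iff hx).trans (mem_componentOfDelete (h.ne_of_mem hx)).symm

theorem eq_of_mem {G' : Set V} (h : IsComponentOfDelete Γ i G) (h' : IsComponentOfDelete Γ i G')
    (hx : x ∈ G) (hx' : x ∈ G') : G = G' := by
  rw [h.eq_componentOfDelete hx, h'.eq_componentOfDelete hx']

theorem nonempty (h : IsComponentOfDelete Γ i G) : G.Nonempty := by
  obtain ⟨x, hx, rfl⟩ := isComponentOfDelete_iff.1 h
  exact ⟨x, self_mem_componentOfDelete hx⟩

theorem mem_of_adj (h : IsComponentOfDelete Γ i G) (hx : x ∈ G) (hxy : Γ.Adj x y) (hy : y ≠ i) :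
    y ∈ G :=
  (h.mem_iff hx).2 (reachable_deleteIncidenceSet_of_adj hxy (h.ne_of_mem hx) hy)

theorem eq_of_adj_of_notMem (h : IsComponentOfDelete Γ i G) (hx : x ∈ G) (hxy : Γ.Adj x y)
    (hy : y ∉ G) : y = i :=
  by_contra fun e => hy (h.mem_of_adj hx hxy e)

theorem exists_adj (h : IsComponentOfDelete Γ i G) (hΓ : Γ.Connected) : ∃ j ∈ G, Γ.Adj i j := by
  by_contra! hG
  obtain ⟨x, hx⟩ := h.nonempty
  have hclosed : ∀ x y, Γ.Adj x y → x ∈ G → y ∈ G := fun x y hxy hx =>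
    h.mem_of_adj hx hxy fun e => hG x hx (e ▸ hxy.symm)
  exact h.notMem ((iff_of_reachable (P := (· ∈ G))
    (fun x y hxy => ⟨hclosed x y hxy, hclosed y x hxy.symm⟩) (hΓ.preconnected x i)).1 hx)

theorem reachable_of_notMem (h : IsComponentOfDelete Γ i G) (hΓ : Γ.Connected)
    (hH : ∀ x ∉ G, ∀ y ∉ G, Γ.Adj x y → H.Adj x y) (hx : x ∉ G) : H.Reachable x i := by
  obtain ⟨p⟩ := hΓ.preconnected x i
  induction p with
  | nil => exact Reachable.refl _
  | @cons a b c hab _ ih =>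
    by_cases hb : b ∈ G
    · rw [h.eq_of_adj_of_notMem hb hab.symm hx]
    · exact (hH a hx b hb hab).reachable.trans (ih h hb)

theorem isCutVertex (h : IsComponentOfDelete Γ i G) (hr : r ∉ G) (hri : r ≠ i) :
    IsCutVertex Γ i := by
  obtain ⟨x, hx⟩ := h.nonempty
  exact isCutVertex_iff.2 ⟨x, r, h.ne_of_mem hx, hri, mt (h.mem_iff hx).2 hr⟩

end IsComponentOfDelete

theorem exists_adj_dist_lt (hΓ : Γ.Connected) (hx : x ≠ r) :
    ∃ y, Γ.Adj x y ∧ Γ.dist y r < Γ.dist x r := by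
  obtain ⟨p, hp⟩ := hΓ.exists_walk_length_eq_dist x r
  cases p with
  | nil => exact absurd rfl hx
  | cons hxy p => exact ⟨_, hxy, hp ▸ Nat.lt_succ_of_le (dist_le p)⟩

theorem dist_lt_of_not_reachable_deleteIncidenceSet (hΓ : Γ.Connected) (hx : x ≠ i)
    (h : ¬ (Γ.deleteIncidenceSet i).Reachable x r) : Γ.dist i r < Γ.dist x r := by
  obtain ⟨p, hp⟩ := hΓ.exists_walk_length_eq_dist x r
  classical
  have hi : i ∈ p.support := by
    by_contra hi
    have hp' : ∀ z ∈ p.support, z ∈ ({i}ᶜ : Set V) := fun z hz e => hi (e ▸ hz)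
    exact h ((reachable_induce_compl_singleton_iff hx (hp' r p.end_mem_support)).1
      ⟨p.induce _ hp'⟩)
  have hdrop := dist_le (p.dropUntil i hi)
  have htake := (hΓ.pos_dist_of_ne hx).trans_le (dist_le (p.takeUntil i hi))
  have hlength := congrArg Walk.length (p.take_spec hi)
  rw [Walk.length_append] at hlength
  omega

theorem IsComponentOfDelete.dist_lt (h : IsComponentOfDelete Γ i G) (hΓ : Γ.Connected)
    (hr : r ∉ G) (hx : x ∈ G) : Γ.dist i r < Γ.dist x r :=
  dist_lt_of_not_reachable_deleteIncidenceSet hΓ (h.ne_of_mem hx) (mt (h.mem_iff hx).2 hr)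

theorem isCutEdge_comm : IsCutEdge Γ i j ↔ IsCutEdge Γ j i := by
  unfold IsCutEdge
  rw [adj_comm, Sym2.eq_swap]

theorem deleteIncidenceSet_le_deleteEdges : Γ.deleteIncidenceSet i ≤ Γ.deleteEdges {s(i, j)} := by
  intro x y h
  obtain ⟨hxy, hx, hy⟩ := Γ.deleteIncidenceSet_adj.1 h
  rw [deleteEdges_adj, Set.mem_singleton_iff, Sym2.eq_iff]
  exact ⟨hxy, by rintro (⟨e, -⟩ | ⟨-, e⟩); exacts [hx e, hy e]⟩

theorem IsComponentOfDelete.mem_iff_of_deleteEdges_adj (h : IsComponentOfDelete Γ i G)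
    (hj : ∀ q ∈ G, Γ.Adj i q → q = j) (hxy : (Γ.deleteEdges {s(i, j)}).Adj x y) :
    x ∈ G ↔ y ∈ G := by
  have hclosed : ∀ x y, (Γ.deleteEdges {s(i, j)}).Adj x y → x ∈ G → y ∈ G := by
    intro x y hxy hx
    rw [deleteEdges_adj, Set.mem_singleton_iff] at hxy
    refine h.mem_of_adj hx hxy.1 ?_
    rintro rfl
    exact hxy.2 (by rw [hj x hx hxy.1.symm, Sym2.eq_swap])
  exact ⟨hclosed x y hxy, hclosed y x hxy.symm⟩

theorem IsComponentOfDelete.isCutEdge_iff (h : IsComponentOfDelete Γ i G) (hΓ : Γ.Connected)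
    (hj : j ∈ G) (hij : Γ.Adj i j) : IsCutEdge Γ i j ↔ ∀ q ∈ G, Γ.Adj i q → q = j := by
  constructor
  · intro hc q hq hiq
    by_contra hqj
    refine hc.2 (hΓ.connected_delete_edge_of_not_isBridge fun hb => hb ?_).preconnected
    have hiq' : (Γ.deleteEdges {s(i, j)}).Adj i q := by
      rw [deleteEdges_adj, Set.mem_singleton_iff, Sym2.congr_right]
      exact ⟨hiq, hqj⟩
    exact hiq'.reachable.trans (((h.mem_iff hq).1 hj).mono deleteIncidenceSet_le_deleteEdges)
  · exact fun huniq => ⟨hij, fun hc => h.notMem ((iff_of_reachable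
      (fun _ _ => h.mem_iff_of_deleteEdges_adj huniq) (hc j i)).1 hj)⟩

theorem IsComponentOfDelete.cutEdgeComponent_eq (h : IsComponentOfDelete Γ i G)
    (hΓ : Γ.Connected) (hj : j ∈ G) (hc : IsCutEdge Γ i j) : cutEdgeComponent Γ j i = G := by
  ext x
  rw [cutEdgeComponent, Set.mem_ofPred_eq, Sym2.eq_swap]
  exact ⟨fun hx => (iff_of_reachable (fun _ _ => h.mem_iff_of_deleteEdges_adj
      ((h.isCutEdge_iff hΓ hj hc.1).1 hc)) hx).1 hj,
    fun hx => ((h.mem_iff hj).1 hx).mono deleteIncidenceSet_le_deleteEdges⟩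

theorem IsComponentOfDelete.cutEdgeComponent_eq_compl (h : IsComponentOfDelete Γ i G)
    (hΓ : Γ.Connected) (hj : j ∈ G) (hc : IsCutEdge Γ i j) : cutEdgeComponent Γ i j = Gᶜ := by
  ext x
  rw [cutEdgeComponent, Set.mem_ofPred_eq, Set.mem_compl_iff]
  refine ⟨fun hx => (not_congr (iff_of_reachable (fun _ _ => h.mem_iff_of_deleteEdges_adj
      ((h.isCutEdge_iff hΓ hj hc.1).1 hc)) hx)).1 h.notMem, fun hx => ?_⟩
  refine (h.reachable_of_notMem hΓ (fun y hy z hz hyz => ?_) hx).symm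
  rw [deleteEdges_adj, Set.mem_singleton_iff, Sym2.eq_iff]
  exact ⟨hyz, by rintro (⟨-, rfl⟩ | ⟨rfl, -⟩); exacts [hz hj, hy hj]⟩

end DeletedGraphs

/-! ### Functions on the symmetric group -/

section Perm

open Equiv MulAction
open scoped Pointwise

variable {V α R : Type*} [DecidableEq V] {x y i j : V}

/-- The group of right translations that fix the function `f`. -/
def rightInvariance {M : Type*} [Group M] (f : M → α) : Subgroup M where
  carrier := {σ | ∀ w, f (w * σ) = f w}
  mul_mem' {σ τ} hσ hτ w := by rw [← mul_assoc, hτ, hσ]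
  one_mem' w := by rw [mul_one]
  inv_mem' {σ} hσ w := by rw [← hσ (w * σ⁻¹), inv_mul_cancel_right]

theorem mem_rightInvariance {M : Type*} [Group M] {f : M → α} {σ : M} :
    σ ∈ rightInvariance f ↔ ∀ w, f (w * σ) = f w :=
  Iff.rfl

theorem eq_of_inv_mul_mem_rightInvariance {M : Type*} [Group M] {f : M → α} {w w' : M}
    (h : w⁻¹ * w' ∈ rightInvariance f) : f w = f w' := by
  rw [← h w, mul_inv_cancel_left]

theorem swap_mem_of_reachable {H : SimpleGraph V} {K : Subgroup (Perm V)}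
    (hK : ∀ x y, H.Adj x y → swap x y ∈ K) (h : H.Reachable x y) : swap x y ∈ K := by
  obtain ⟨p⟩ := h
  induction p with
  | nil => rw [swap_self]; exact K.one_mem
  | cons hxy _ ih => exact SubmonoidClass.swap_mem_trans K (hK _ _ hxy) ih

theorem mem_of_forall_swap_apply_mem [Finite V] {K : Subgroup (Perm V)} {σ : Perm V}
    (h : ∀ x, σ x ≠ x → swap x (σ x) ∈ K) : σ ∈ K := by
  have hle : Subgroup.closure {τ | τ ∈ K ∧ τ.IsSwap} ≤ K :=
    (Subgroup.closure_le K).2 fun τ hτ => hτ.1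
  refine hle ((mem_closure_isSwap fun τ hτ => hτ.2).2 ⟨Set.toFinite _, fun x => ?_⟩)
  by_cases hx : σ x = x
  · rw [hx]
    exact mem_orbit_self x
  · exact ⟨⟨swap x (σ x), Subgroup.subset_closure ⟨h x hx, x, σ x, Ne.symm hx, rfl⟩⟩,
      swap_apply_left x (σ x)⟩

theorem eq_top_of_forall_swap_mem [Finite V] {K : Subgroup (Perm V)} (h : ∀ x, swap x i ∈ K) :
    K = ⊤ :=
  (Subgroup.eq_top_iff' K).2 fun σ => mem_of_forall_swap_apply_mem fun x _ =>
    SubmonoidClass.swap_mem_trans K (h x) (swap_comm (σ x) i ▸ h (σ x))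

theorem swap_smul_finset {S : Finset V} (h : x ∈ S ↔ y ∈ S) : swap x y • S = S := by
  rw [← mem_stabilizer_iff, ← stabilizer_coe_finset]
  exact swap_mem_stabilizer.2 h

theorem exists_smul_finset_eq [Finite V] {S T : Finset V} (h : T.card = S.card) :
    ∃ w : Perm V, w • S = T := by
  have := Fintype.ofFinite V
  obtain ⟨w, hw⟩ := (Set.powersetCard.isPretransitive (α := V) (n := S.card)).exists_smul_eq
    ⟨S, rfl⟩ ⟨T, h⟩
  exact ⟨w, congrArg Subtype.val hw⟩

theorem exists_eq_comp_smul_finset [Finite V] [Nonempty α] {f : Perm V → α} {S : Finset V}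
    (h : ∀ x y, (x ∈ S ↔ y ∈ S) → swap x y ∈ rightInvariance f) :
    ∃ u : Finset V → α, ∀ w, f w = u (w • S) := by
  suffices hf : f.FactorsThrough (fun w => w • S) by
    obtain ⟨u, hu⟩ := (Function.factorsThrough_iff f).1 hf
    exact ⟨u, congrFun hu⟩
  intro w w' (hww' : w • S = w' • S)
  refine eq_of_inv_mul_mem_rightInvariance (mem_of_forall_swap_apply_mem fun x _ => h _ _ ?_)
  have hstab : w⁻¹ * w' ∈ stabilizer (Perm V) S := by
    rw [mem_stabilizer_iff, mul_smul, ← hww', inv_smul_smul]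
  exact (mem_stabilizer_finset.1 hstab x).symm

theorem exists_eq_comp_apply_pair [Finite V] [Nonempty α] {f : Perm V → α}
    (h : ∀ x y, x ≠ i → x ≠ j → y ≠ i → y ≠ j → swap x y ∈ rightInvariance f) :
    ∃ d : V → V → α, ∀ w, f w = d (w i) (w j) := by
  suffices hf : f.FactorsThrough (fun w => (w i, w j)) by
    obtain ⟨u, hu⟩ := (Function.factorsThrough_iff f).1 hf
    exact ⟨Function.curry u, congrFun hu⟩
  intro w w' hww'
  obtain ⟨hi, hj⟩ := Prod.ext_iff.1 hww'
  refine eq_of_inv_mul_mem_rightInvariance (mem_of_forall_swap_apply_mem fun x hx => ?_)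
  have hne {k : V} (hk : w k = w' k) : x ≠ k ∧ (w⁻¹ * w') x ≠ k := by
    have hfix : (w⁻¹ * w') k = k := Perm.inv_eq_iff_eq.2 hk.symm
    have hxk : x ≠ k := by rintro rfl; exact hx hfix
    exact ⟨hxk, fun e => hxk ((w⁻¹ * w').injective (e.trans hfix.symm))⟩
  exact h _ _ (hne hi).1 (hne hj).1 (hne hi).2 (hne hj).2

variable [CommRing R]

variable (R) in
/-- The difference `f - f (· * (i, j))`, along the edges in the direction of the transposition
`(i, j)` of the Cayley graph, as a linear map. -/
def swapDiff (i j : V) : (Perm V → R) →ₗ[R] (Perm V → R) :=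
  LinearMap.id - LinearMap.funLeft R R (· * swap i j)

theorem swapDiff_apply (f : Perm V → R) (w : Perm V) :
    swapDiff R i j f w = f w - f (w * swap i j) :=
  rfl

theorem swapDiff_eq_zero_iff {f : Perm V → R} :
    swapDiff R i j f = 0 ↔ swap i j ∈ rightInvariance f := by
  simp only [funext_iff, swapDiff_apply, Pi.zero_apply, sub_eq_zero, mem_rightInvariance, eq_comm]

theorem mem_rightInvariance_swapDiff {f : Perm V → R} {σ : Perm V} (hσ : σ ∈ rightInvariance f)
    (hc : Commute (swap i j) σ) : σ ∈ rightInvariance (swapDiff R i j f) := by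
  intro w
  rw [swapDiff_apply, swapDiff_apply, hσ, mul_assoc, ← hc.eq, ← mul_assoc, hσ]

theorem swapDiff_cycle {f : Perm V → R} {k : V} (hf : swap j k ∈ rightInvariance f) (hij : i ≠ j)
    (hik : i ≠ k) (hjk : j ≠ k) (w : Perm V) :
    swapDiff R i j f w + swapDiff R i j f (w * swap i j * swap j k) +
      swapDiff R i j f (w * swap j k * swap i j) = 0 := by
  have hbraid : swap i j * (swap j k * swap i j) = swap j k * (swap i j * swap j k) := by
    rw [← mul_assoc, ← mul_assoc, swap_mul_swap_mul_swap hij hik, swap_comm j k, swap_comm i j,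
      swap_mul_swap_mul_swap hjk.symm hik.symm, swap_comm]
  simp only [swapDiff_apply, mul_assoc, hbraid]
  simp only [← mul_assoc, hf _, mul_swap_mul_self]
  ring

/-- The triangle identity turns an antisymmetric function of a pair of values into a
difference: the potential at `x` is its value at the pair `(x, i)`. -/
theorem exists_swapDiff_eq_sub [Finite V] {f : Perm V → R} {k : V}
    (hf : swap j k ∈ rightInvariance f) (hij : i ≠ j) (hik : i ≠ k) (hjk : j ≠ k)
    (h : ∀ x y, x ≠ i → x ≠ j → y ≠ i → y ≠ j → swap x y ∈ rightInvariance (swapDiff R i j f)) :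
    ∃ g : V → R, ∀ w, swapDiff R i j f w = g (w j) - g (w i) := by
  obtain ⟨d, hd⟩ := exists_eq_comp_apply_pair (i := j) (j := i)
    fun x y hxj hxi hyj hyi => h x y hxi hxj hyi hyj
  have hanti (w : Perm V) : d (w j) (w i) = -d (w i) (w j) := by
    have hs := hd (w * swap i j)
    rw [swapDiff_apply, mul_swap_mul_self, ← neg_sub, ← swapDiff_apply, hd] at hs
    simpa using congrArg Neg.neg hs
  have hcycle (w : Perm V) : d (w j) (w i) + d (w k) (w j) + d (w i) (w k) = 0 := by
    simpa [hd, swap_apply_of_ne_of_ne hij hik, swap_apply_of_ne_of_ne hik.symm hjk.symm]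
      using swapDiff_cycle hf hij hik hjk w
  refine ⟨fun x => if x = i then 0 else d x i, fun w => ?_⟩
  simp only [hd]
  by_cases hwj : w j = i
  · have hwi : w i ≠ i := fun e => hij (w.injective (e.trans hwj.symm))
    rw [if_pos hwj, if_neg hwi, hanti, hwj, zero_sub]
  by_cases hwi : w i = i
  · rw [if_neg hwj, if_pos hwi, hwi, sub_zero]
  let w' := w * swap k (w⁻¹ i)
  have hk : w' k = i := by simp [w']
  have hfix {p : V} (hp : w p ≠ i) (hpk : p ≠ k) : w' p = w p := by
    rw [Perm.mul_apply, swap_apply_of_ne_of_ne hpk (mt Perm.eq_inv_iff_eq.1 hp)]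
  have hcyc := hcycle w'
  have hant : d (w j) i = -d i (w j) := by
    simpa [hk, hfix hwj hjk, swap_apply_of_ne_of_ne hij.symm hjk] using hanti (w' * swap i k)
  rw [hk, hfix hwj hjk, hfix hwi hik] at hcyc
  rw [if_neg hwj, if_neg hwi]
  linear_combination hcyc - hant

end Perm

/-! ### Coordinates of linear splines -/

section CoordSplines

open Equiv MulAction
open scoped Pointwise

variable {V R : Type*} [Fintype V] [DecidableEq V] [CommRing R] {Γ : SimpleGraph V}
  {i j x y : V} {a : V → Perm V → R}

variable (R Γ) in
/-- The coordinates of the linear splines of `Γ`: a linear form at `w` is written as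
`∑ p, a p w • t_{w(p)}`, so that the spline condition along an edge `(i, j)` relates only
coefficients at the same position `p`. -/
def coordSplines : Submodule R (V → Perm V → R) where
  carrier := {a | ∀ i j, Γ.Adj i j → ∀ w,
    (∀ p, p ≠ i → p ≠ j → a p (w * swap i j) = a p w) ∧
      ∑ p, a p (w * swap i j) = ∑ p, a p w}
  add_mem' ha hb i j hij w :=
    ⟨fun p hi hj => congrArg₂ (· + ·) ((ha i j hij w).1 p hi hj) ((hb i j hij w).1 p hi hj), by
      simp only [Pi.add_apply, Finset.sum_add_distrib, (ha i j hij w).2, (hb i j hij w).2]⟩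
  zero_mem' _ _ _ _ := ⟨fun _ _ _ => rfl, rfl⟩
  smul_mem' c _ ha i j hij w :=
    ⟨fun p hi hj => congrArg (c • ·) ((ha i j hij w).1 p hi hj), by
      simp only [Pi.smul_apply, ← Finset.smul_sum, (ha i j hij w).2]⟩

theorem const_mem_coordSplines (c : V → R) : (fun p _ => c p) ∈ coordSplines R Γ :=
  fun _ _ _ _ => ⟨fun _ _ _ => rfl, rfl⟩

theorem swap_mem_rightInvariance (ha : a ∈ coordSplines R Γ) (hij : Γ.Adj i j) {p : V}
    (hi : p ≠ i) (hj : p ≠ j) : swap i j ∈ rightInvariance (a p) :=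
  fun w => (ha i j hij w).1 p hi hj

theorem swap_mem_rightInvariance_sum (ha : a ∈ coordSplines R Γ) (hij : Γ.Adj i j)
    {T : Finset V} (hT : i ∈ T ↔ j ∈ T) :
    swap i j ∈ rightInvariance (fun w => ∑ p ∈ T, a p w) := by
  have hsum {S : Finset V} (hi : i ∉ S) (hj : j ∉ S) (w : Perm V) :
      ∑ p ∈ S, a p (w * swap i j) = ∑ p ∈ S, a p w :=
    Finset.sum_congr rfl fun p hp => swap_mem_rightInvariance ha hij
      (ne_of_mem_of_not_mem hp hi) (ne_of_mem_of_not_mem hp hj) w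
  intro w
  by_cases hi : i ∈ T
  · have htotal := (ha i j hij w).2
    rwa [← Finset.sum_add_sum_compl T, ← Finset.sum_add_sum_compl T, hsum (S := Tᶜ)
      (by simpa using hi) (by simpa [← hT] using hi), add_left_inj] at htotal
  · exact hsum hi (mt hT.2 hi) w

theorem swapDiff_eq_zero (ha : a ∈ coordSplines R Γ) (hij : Γ.Adj i j) (hi : a i = 0) :
    swapDiff R i j (a j) = 0 := by
  have h := swap_mem_rightInvariance_sum ha hij (T := {i, j}) (by simp)
  simpa only [swapDiff_eq_zero_iff, Finset.sum_pair hij.ne, hi, Pi.zero_apply, zero_add] using h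

theorem swapDiff_sum (ha : a ∈ coordSplines R Γ) (hij : Γ.Adj i j) {S : Finset V} (hi : i ∉ S)
    (hj : j ∈ S) : swapDiff R i j (fun w => ∑ p ∈ S, a p w) = swapDiff R i j (a j) := by
  funext w
  rw [swapDiff_apply, swapDiff_apply, ← Finset.add_sum_erase S _ hj, ← Finset.add_sum_erase S _ hj,
    Finset.sum_congr rfl fun p hp => swap_mem_rightInvariance ha hij
      (ne_of_mem_of_not_mem (Finset.mem_of_mem_erase hp) hi) (Finset.ne_of_mem_erase hp) w,
    add_sub_add_right_eq_sub]

end CoordSplines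

/-! ### Jumps across pendant components -/

section Jumps

open Equiv
open scoped Pointwise

variable {V R : Type*} [Fintype V] [DecidableEq V] [CommRing R] {Γ : SimpleGraph V}
  {i j k r : V} {S : Finset V} {a : V → Perm V → R}

theorem swap_mem_rightInvariance_of_reachable {p x y : V} (ha : a ∈ coordSplines R Γ)
    (h : (Γ.deleteIncidenceSet p).Reachable x y) : swap x y ∈ rightInvariance (a p) := by
  refine swap_mem_of_reachable (fun y z hyz => ?_) h
  obtain ⟨hadj, hy, hz⟩ := Γ.deleteIncidenceSet_adj.1 hyz
  exact swap_mem_rightInvariance ha hadj hy.symm hz.symm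

theorem rightInvariance_eq_top (hΓ : Γ.Connected) (ha : a ∈ coordSplines R Γ)
    (h : ∀ i (S : Finset V), IsComponentOfDelete Γ i ↑S → r ∉ S →
      ∃ j ∈ S, Γ.Adj i j ∧ swapDiff R i j (a j) = 0) (p : V) : rightInvariance (a p) = ⊤ := by
  induction hd : Γ.dist p r using Nat.strong_induction_on generalizing p with
  | _ d ih =>
  subst hd
  have hadj (q : V) (hpq : Γ.Adj p q) (hq : swap p q ∈ rightInvariance (a q)) :
      swap p q ∈ rightInvariance (a p) := by
    intro w
    have hsum := swap_mem_rightInvariance_sum ha hpq (T := {p, q}) (by simp) w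
    simpa only [Finset.sum_pair hpq.ne, hq w, add_left_inj] using hsum
  refine eq_top_of_forall_swap_mem (i := p) fun x => ?_
  rcases eq_or_ne x p with rfl | hx
  · rw [swap_self]
    exact one_mem _
  obtain ⟨S, hS⟩ := (Set.toFinite (componentOfDelete Γ p x)).exists_finset_coe
  have hSp : IsComponentOfDelete Γ p ↑S := hS ▸ isComponentOfDelete_componentOfDelete hx
  obtain ⟨q, hqS, hpq, hq⟩ : ∃ q ∈ S, Γ.Adj p q ∧ swap p q ∈ rightInvariance (a q) := by
    by_cases hr : r ∈ S
    · obtain ⟨q, hpq, hdist⟩ := exists_adj_dist_lt hΓ (hSp.ne_of_mem hr).symm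
      refine ⟨q, by_contra fun hqS => ?_, hpq, ih _ hdist q rfl ▸ Subgroup.mem_top _⟩
      refine (dist_lt_of_not_reachable_deleteIncidenceSet hΓ hpq.ne' ?_).not_gt hdist
      exact fun hqr => hqS ((hSp.mem_iff hr).2 hqr.symm)
    · obtain ⟨q, hqS, hpq, hq⟩ := h p S hSp hr
      exact ⟨q, hqS, hpq, swapDiff_eq_zero_iff.1 hq⟩
  have hxq : swap x q ∈ rightInvariance (a p) :=
    swap_mem_rightInvariance_of_reachable ha
      ((mem_componentOfDelete hx).1 (hS ▸ hqS : q ∈ componentOfDelete Γ p x))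
  exact SubmonoidClass.swap_mem_trans _ hxq (swap_comm p q ▸ hadj q hpq hq)

theorem exists_swapDiff_eq_of_isCutEdge (hΓ : Γ.Connected) (hS : IsComponentOfDelete Γ i ↑S)
    (hj : j ∈ S) (hc : IsCutEdge Γ i j) (ha : a ∈ coordSplines R Γ) :
    ∃ u : Finset V → R, swapDiff R i j (a j) = swapDiff R i j fun w => u (w • S) := by
  have hi : i ∉ S := hS.notMem
  have hadj {x y : V} (hxy : (Γ.deleteEdges {s(i, j)}).Adj x y) :
      swap x y ∈ rightInvariance fun w => ∑ p ∈ S, a p w :=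
    swap_mem_rightInvariance_sum ha (deleteEdges_le _ hxy)
      (hS.mem_iff_of_deleteEdges_adj ((hS.isCutEdge_iff hΓ hj hc.1).1 hc) hxy)
  have hreach {x y : V} (hxy : x ∈ S ↔ y ∈ S) : (Γ.deleteEdges {s(i, j)}).Reachable x y := by
    by_cases hx : x ∈ S
    · have heq := hS.cutEdgeComponent_eq hΓ hj hc
      rw [cutEdgeComponent, Sym2.eq_swap] at heq
      exact (heq.ge hx : Reachable _ j x).symm.trans (heq.ge (hxy.1 hx))
    · have heq := hS.cutEdgeComponent_eq_compl hΓ hj hc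
      exact (heq.ge hx : Reachable _ i x).symm.trans (heq.ge (mt hxy.2 hx))
  obtain ⟨u, hu⟩ := exists_eq_comp_smul_finset (S := S) (f := fun w => ∑ p ∈ S, a p w)
    fun x y hxy => swap_mem_of_reachable (fun _ _ => hadj) (hreach hxy)
  exact ⟨u, by rw [← swapDiff_sum ha hc.1 hi hj, funext hu]⟩

theorem exists_swapDiff_eq_of_ne (hΓ : Γ.Connected) (hS : IsComponentOfDelete Γ i ↑S)
    (hj : j ∈ S) (hij : Γ.Adj i j) (hk : k ∈ S) (hik : Γ.Adj i k) (hjk : j ≠ k)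
    (ha : a ∈ coordSplines R Γ) :
    ∃ g : V → R, ∀ w, swapDiff R i j (a j) w = g (w j) - g (w i) := by
  have hi : i ∉ S := hS.notMem
  have hsum : ∀ x ∈ S, swap x k ∈ rightInvariance fun w => ∑ p ∈ S, a p w := fun x hx =>
    swap_mem_of_reachable (fun y z hyz => by
        obtain ⟨hadj, hy, hz⟩ := Γ.deleteIncidenceSet_adj.1 hyz
        exact swap_mem_rightInvariance_sum ha hadj
          ⟨fun h => hS.mem_of_adj h hadj hz, fun h => hS.mem_of_adj h hadj.symm hy⟩)
      ((hS.mem_iff hx).1 hk)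
  have hcoord : ∀ x ∉ S, swap x k ∈ rightInvariance (a j) := fun x hx =>
    swap_mem_rightInvariance_of_reachable ha
      ((hS.reachable_of_notMem hΓ (fun y hy z hz hyz => Γ.deleteIncidenceSet_adj.2
          ⟨hyz, by rintro rfl; exact hy hj, by rintro rfl; exact hz hj⟩) hx).trans
        (reachable_deleteIncidenceSet_of_adj hik hij.ne hjk.symm))
  have heq := swapDiff_sum ha hij hi hj
  have hswap (x : V) (hxi : x ≠ i) (hxj : x ≠ j) :
      swap x k ∈ rightInvariance (swapDiff R i j (a j)) := by
    have hcomm : Commute (swap i j) (swap x k) := by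
      rcases eq_or_ne x k with rfl | hxk
      · rw [swap_self]
        exact Commute.one_right _
      · refine (Perm.disjoint_swap_swap ?_).commute
        simp [hij.ne, hxi.symm, hxj.symm, hik.ne, hjk, hxk]
    by_cases hx : x ∈ S
    · rw [← heq]
      exact mem_rightInvariance_swapDiff (hsum x hx) hcomm
    · exact mem_rightInvariance_swapDiff (hcoord x hx) hcomm
  rw [← heq]
  refine exists_swapDiff_eq_sub (hsum j hj) hij.ne hik.ne hjk fun x y hxi hxj hyi hyj => ?_
  rw [heq]
  exact SubmonoidClass.swap_mem_trans _ (hswap x hxi hxj) (swap_comm y k ▸ hswap y hyi hyj)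

end Jumps

/-! ### Splines attached to pendant components -/

section Pendants

open Equiv MulAction
open scoped Pointwise

variable {V : Type*} {Γ : SimpleGraph V} {i j k : V}

open Classical in
/-- A neighbour of `i` in `S`, if there is one. -/
def neighborIn (Γ : SimpleGraph V) (i : V) (S : Finset V) : V :=
  if h : ∃ j ∈ S, Γ.Adj i j then h.choose else i

theorem neighborIn_mem_and_adj {S : Finset V} (hΓ : Γ.Connected)
    (hS : IsComponentOfDelete Γ i ↑S) : neighborIn Γ i S ∈ S ∧ Γ.Adj i (neighborIn Γ i S) := by
  have h : ∃ j ∈ S, Γ.Adj i j := hS.exists_adj hΓ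
  rw [neighborIn, dif_pos h]
  exact h.choose_spec

open Classical in
/-- For a component `S` of `Γ - i`, the positions whose image under `w` determines the linear
spline attached to `(i, S)`: all of `S` if an edge from `i` to `S` is a cut edge, and a neighbour of
`i` in `S` otherwise. -/
def marked (Γ : SimpleGraph V) (i : V) (S : Finset V) : Finset V :=
  if IsCutEdge Γ i (neighborIn Γ i S) then S else {neighborIn Γ i S}

theorem neighborIn_mem_marked {S : Finset V} (hΓ : Γ.Connected)
    (hS : IsComponentOfDelete Γ i ↑S) : neighborIn Γ i S ∈ marked Γ i S := by
  unfold marked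
  split_ifs
  · exact (neighborIn_mem_and_adj hΓ hS).1
  · exact Finset.mem_singleton_self _

theorem notMem_marked {S : Finset V} (hΓ : Γ.Connected) (hS : IsComponentOfDelete Γ i ↑S) :
    i ∉ marked Γ i S := by
  unfold marked
  split_ifs
  · exact hS.notMem
  · exact Finset.notMem_singleton.2 (neighborIn_mem_and_adj hΓ hS).2.ne

variable {R : Type*} [DecidableEq V] [CommRing R]

variable (V R) in
/-- The family of linear forms `f w • (t_{w(j)} - t_{w(i)})`, in coordinates. -/
def differenceCoords (i j : V) : (Perm V → R) →ₗ[R] (V → Perm V → R) :=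
  LinearMap.single R (fun _ => Perm V → R) j - LinearMap.single R (fun _ => Perm V → R) i

theorem differenceCoords_apply (f : Perm V → R) (p : V) (w : Perm V) :
    differenceCoords V R i j f p w =
      (if p = j then f w else 0) - (if p = i then f w else 0) := by
  simp only [differenceCoords, LinearMap.sub_apply, LinearMap.single_apply, Pi.sub_apply,
    Pi.single_apply, ite_apply, Pi.zero_apply]

theorem sum_differenceCoords [Fintype V] (f : Perm V → R) (w : Perm V) :
    ∑ p, differenceCoords V R i j f p w = 0 := by
  simp [differenceCoords_apply]

variable (R) in
/-- Coordinates of a combination of the splines `f̄_A^s`, `s = (i, j)`, where `u A` is the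
coefficient of the one with value `t_{w(j)} - t_{w(i)}` if `w(S) = A`. -/
def cosetCoords (i j : V) (S : Finset V) : (Finset V → R) →ₗ[R] (V → Perm V → R) :=
  differenceCoords V R i j ∘ₗ LinearMap.funLeft R R (· • S)

theorem cosetCoords_apply (S : Finset V) (u : Finset V → R) (p : V) (w : Perm V) :
    cosetCoords R i j S u p w =
      (if p = j then u (w • S) else 0) - (if p = i then u (w • S) else 0) :=
  differenceCoords_apply _ p w

theorem cosetCoords_mem [Fintype V] {S : Finset V}
    (hS : ∀ x y, Γ.Adj x y → s(x, y) ≠ s(i, j) → (x ∈ S ↔ y ∈ S)) (u : Finset V → R) :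
    cosetCoords R i j S u ∈ coordSplines R Γ := by
  intro x y hxy w
  refine ⟨fun p hpx hpy => ?_, by
    simp only [cosetCoords, LinearMap.comp_apply, sum_differenceCoords]⟩
  rw [cosetCoords_apply, cosetCoords_apply]
  by_cases he : s(x, y) = s(i, j)
  · have hp : p ∉ s(i, j) := by rw [← he, Sym2.mem_iff]; tauto
    rw [Sym2.mem_iff, not_or] at hp
    simp [hp.1, hp.2]
  · rw [mul_smul, swap_smul_finset (hS x y hxy he)]

theorem cosetCoords_mem_of_isCutEdge [Fintype V] {S : Finset V} (hΓ : Γ.Connected)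
    (hS : IsComponentOfDelete Γ i ↑S) (hj : j ∈ S) (hc : IsCutEdge Γ i j) (u : Finset V → R) :
    cosetCoords R i j S u ∈ coordSplines R Γ := by
  refine cosetCoords_mem (fun x y hxy hne => hS.mem_iff_of_deleteEdges_adj
    ((hS.isCutEdge_iff hΓ hj hc.1).1 hc) ?_) u
  rw [deleteEdges_adj]
  exact ⟨hxy, hne⟩

variable (R) in
/-- Coordinates of a combination of the splines `ȳ^i_{S,k}`, where `u k` is the coefficient of
the one with value `t_k - t_{w(i)}` if `w⁻¹(k) ∈ S`. -/
def cutVertexCoords (i : V) (S : Finset V) : (V → R) →ₗ[R] (V → Perm V → R) :=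
  ∑ q ∈ S, differenceCoords V R i q ∘ₗ LinearMap.funLeft R R (fun w : Perm V => w q)

theorem cutVertexCoords_apply (S : Finset V) (u : V → R) (p : V) (w : Perm V) :
    cutVertexCoords R i S u p w =
      (if p ∈ S then u (w p) else 0) - if p = i then ∑ q ∈ S, u (w q) else 0 := by
  simp only [cutVertexCoords, LinearMap.sum_apply, Finset.sum_apply, LinearMap.comp_apply,
    differenceCoords_apply, Finset.sum_sub_distrib, LinearMap.funLeft_apply, Finset.sum_ite_eq,
    Finset.sum_ite_irrel, Finset.sum_const_zero]

theorem cutVertexCoords_mem [Fintype V] {S : Finset V} (hS : IsComponentOfDelete Γ i ↑S)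
    (u : V → R) : cutVertexCoords R i S u ∈ coordSplines R Γ := by
  intro x y hxy w
  refine ⟨fun p hpx hpy => ?_, ?_⟩
  · rw [cutVertexCoords_apply, cutVertexCoords_apply, Perm.mul_apply,
      swap_apply_of_ne_of_ne hpx hpy]
    rcases eq_or_ne p i with rfl | hp
    · have hmem : x ∈ S ↔ y ∈ S :=
        ⟨fun h => hS.mem_of_adj h hxy hpy.symm, fun h => hS.mem_of_adj h hxy.symm hpx.symm⟩
      have hsum : ∑ q ∈ S, u ((w * swap x y) q) = ∑ q ∈ S, u (w q) :=
        Finset.sum_equiv (swap x y)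
          (fun q => (mem_stabilizer_finset.1 (swap_smul_finset hmem) q).symm) fun _ _ => rfl
      rw [hsum]
    · simp [hp]
  · simp only [cutVertexCoords, LinearMap.sum_apply, Finset.sum_apply, LinearMap.comp_apply]
    rw [Finset.sum_comm, Finset.sum_comm (s := Finset.univ)]
    simp only [sum_differenceCoords]

variable (R) in
open Classical in
/-- Coordinates of the linear spline attached to a component `S` of `Γ - i`, with coefficient
`u (w (marked Γ i S))` at the position `neighborIn Γ i S`. -/
def pendantCoords (Γ : SimpleGraph V) (i : V) (S : Finset V) :
    (Finset V → R) →ₗ[R] (V → Perm V → R) :=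
  if IsCutEdge Γ i (neighborIn Γ i S) then cosetCoords R i (neighborIn Γ i S) S
  else cutVertexCoords R i S ∘ₗ LinearMap.funLeft R R singleton

theorem pendantCoords_mem [Fintype V] {S : Finset V} (hΓ : Γ.Connected)
    (hS : IsComponentOfDelete Γ i ↑S) (u : Finset V → R) :
    pendantCoords R Γ i S u ∈ coordSplines R Γ := by
  unfold pendantCoords
  split_ifs with hc
  · exact cosetCoords_mem_of_isCutEdge hΓ hS (neighborIn_mem_and_adj hΓ hS).1 hc u
  · exact cutVertexCoords_mem hS _

theorem pendantCoords_eq_zero {S : Finset V} (hΓ : Γ.Connected)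
    (hS : IsComponentOfDelete Γ i ↑S) {p : V} (hp : p ∉ S) (hpi : p ≠ i) (u : Finset V → R) :
    pendantCoords R Γ i S u p = 0 := by
  have hpj : p ≠ neighborIn Γ i S :=
    (ne_of_mem_of_not_mem (neighborIn_mem_and_adj hΓ hS).1 hp).symm
  funext w
  unfold pendantCoords
  split_ifs
  · simp [cosetCoords_apply, hpi, hpj]
  · simp [cutVertexCoords_apply, hp, hpi]

theorem pendantCoords_neighborIn {S : Finset V} (hΓ : Γ.Connected)
    (hS : IsComponentOfDelete Γ i ↑S) (u : Finset V → R) :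
    pendantCoords R Γ i S u (neighborIn Γ i S) = fun w => u (w • marked Γ i S) := by
  obtain ⟨hj, hij⟩ := neighborIn_mem_and_adj hΓ hS
  funext w
  unfold pendantCoords marked
  split_ifs
  · simp [cosetCoords_apply, hij.ne']
  · simp [cutVertexCoords_apply, hj, hij.ne', LinearMap.funLeft_apply]

theorem swapDiff_pendantCoords_eq_zero [Finite V] {S T : Finset V} (hΓ : Γ.Connected)
    (hS : IsComponentOfDelete Γ i ↑S) (hT : IsComponentOfDelete Γ k ↑T) (hi : i ∉ T)
    (hne : (k, T) ≠ (i, S)) (u : Finset V → R) :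
    swapDiff R i (neighborIn Γ i S) (pendantCoords R Γ k T u (neighborIn Γ i S)) = 0 := by
  have := Fintype.ofFinite V
  obtain ⟨hj, hij⟩ := neighborIn_mem_and_adj hΓ hS
  rcases eq_or_ne i k with rfl | hik
  · rw [pendantCoords_eq_zero hΓ hT (fun hjT => hne ?_) hij.ne', map_zero]
    rw [Finset.coe_injective (hS.eq_of_mem hT hj hjT)]
  · exact swapDiff_eq_zero (pendantCoords_mem hΓ hT u) hij (pendantCoords_eq_zero hΓ hT hi hik u)

theorem exists_swapDiff_eq [Fintype V] {S : Finset V} {a : V → Perm V → R} (hΓ : Γ.Connected)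
    (hS : IsComponentOfDelete Γ i ↑S) (ha : a ∈ coordSplines R Γ) :
    ∃ u : Finset V → R, swapDiff R i (neighborIn Γ i S) (a (neighborIn Γ i S)) =
      swapDiff R i (neighborIn Γ i S) fun w => u (w • marked Γ i S) := by
  obtain ⟨hj, hij⟩ := neighborIn_mem_and_adj hΓ hS
  unfold marked
  split_ifs with hc
  · exact exists_swapDiff_eq_of_isCutEdge hΓ hS hj hc ha
  · rw [hS.isCutEdge_iff hΓ hj hij] at hc
    push Not at hc
    obtain ⟨k, hk, hik, hkj⟩ := hc
    obtain ⟨g, hg⟩ := exists_swapDiff_eq_of_ne hΓ hS hj hij hk hik hkj.symm ha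
    refine ⟨fun A => ∑ x ∈ A, g x, funext fun w => ?_⟩
    rw [hg, swapDiff_apply]
    simp

theorem rightInvariance_comp_smul_eq_top [Finite V] {α : Type*} {S : Finset V} {u : Finset V → α}
    (hi : i ∉ S) (hj : j ∈ S) (h : swap i j ∈ rightInvariance fun w : Perm V => u (w • S)) :
    rightInvariance (fun w : Perm V => u (w • S)) = ⊤ := by
  have hS {x y : V} (hxy : x ∈ S ↔ y ∈ S) :
      swap x y ∈ rightInvariance fun w : Perm V => u (w • S) := fun w => by
    change u ((w * swap x y) • S) = u (w • S)
    rw [mul_smul, swap_smul_finset hxy]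
  refine eq_top_of_forall_swap_mem (i := i) fun x => ?_
  by_cases hx : x ∈ S
  · exact SubmonoidClass.swap_mem_trans _ (hS (iff_of_true hx hj)) (swap_comm i j ▸ h)
  · exact hS (iff_of_false hx hi)

end Pendants

/-! ### A parametrization of the linear splines -/

section Parametrization

open Equiv MulAction
open scoped Pointwise

variable {V R : Type*} [Fintype V] [DecidableEq V] [CommRing R] {Γ : SimpleGraph V} {r : V}

/-- The sets `A ≠ S` with as many elements as `S`. A function on the images `w(S)` of `S` is
determined up to an additive constant by its differences with the value at `S`, and these are
indexed by `sameCard S`. -/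
def sameCard (S : Finset V) : Finset (Finset V) :=
  (Finset.univ.powersetCard S.card).erase S

theorem mem_sameCard {S A : Finset V} : A ∈ sameCard S ↔ A ≠ S ∧ A.card = S.card := by
  simp [sameCard]

theorem card_sameCard (S : Finset V) :
    (sameCard S).card = (Fintype.card V).choose S.card - 1 := by
  rw [sameCard, Finset.card_erase_of_mem (by simp), Finset.card_powersetCard, Finset.card_univ]

variable (R) in
/-- Extension by zero of a function on `sameCard S`. -/
def extendByZero (S : Finset V) : (sameCard S → R) →ₗ[R] (Finset V → R) :=
  Function.ExtendByZero.linearMap R Subtype.val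

theorem extendByZero_of_mem {S A : Finset V} (u : sameCard S → R) (hA : A ∈ sameCard S) :
    extendByZero R S u A = u ⟨A, hA⟩ :=
  Subtype.val_injective.extend_apply u 0 ⟨A, hA⟩

theorem extendByZero_of_notMem {S A : Finset V} (u : sameCard S → R) (hA : A ∉ sameCard S) :
    extendByZero R S u A = 0 :=
  Function.extend_apply' _ _ _ fun ⟨B, hB⟩ => hA (hB ▸ B.2)

theorem extendByZero_self (S : Finset V) (u : sameCard S → R) : extendByZero R S u S = 0 :=
  extendByZero_of_notMem u fun h => (mem_sameCard.1 h).1 rfl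

theorem extendByZero_eq_sum_single (S : Finset V) (u : sameCard S → R) :
    extendByZero R S u = ∑ A, u A • Pi.single (M := fun _ => R) A.1 1 := by
  funext A
  simp only [Finset.sum_apply, Pi.smul_apply, Pi.single_apply, smul_eq_mul, mul_ite, mul_one,
    mul_zero]
  by_cases hA : A ∈ sameCard S
  · rw [extendByZero_of_mem u hA, Fintype.sum_eq_single ⟨A, hA⟩, if_pos rfl]
    exact fun B hB => if_neg fun h => hB (Subtype.ext h.symm)
  · rw [extendByZero_of_notMem u hA, Finset.sum_eq_zero]
    exact fun B _ => if_neg fun (h : A = B) => hA (h ▸ B.2)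

theorem eq_zero_of_rightInvariance_eq_top {S : Finset V} {u : sameCard S → R}
    (h : rightInvariance (fun w : Perm V => extendByZero R S u (w • S)) = ⊤) : u = 0 := by
  funext ⟨A, hA⟩
  obtain ⟨w, rfl⟩ := exists_smul_finset_eq (mem_sameCard.1 hA).2
  have hw := mem_rightInvariance.1 (h ▸ Subgroup.mem_top w) 1
  rw [one_mul, one_smul, extendByZero_self, extendByZero_of_mem u hA] at hw
  exact hw

theorem exists_extendByZero_smul_eq (S : Finset V) (v : Finset V → R) :
    ∃ u : sameCard S → R, ∀ w : Perm V, extendByZero R S u (w • S) = v (w • S) - v S := by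
  refine ⟨fun A => v A - v S, fun w => ?_⟩
  by_cases hw : w • S = S
  · rw [hw, extendByZero_self, sub_self]
  · exact extendByZero_of_mem _ (mem_sameCard.2 ⟨hw, Finset.card_smul_finset w S⟩)

open Classical in
/-- The pairs of a vertex `i` and a component of `Γ - i` not containing the root `r`. -/
def pendants (Γ : SimpleGraph V) (r : V) : Finset (V × Finset V) :=
  {π | IsComponentOfDelete Γ π.1 ↑π.2 ∧ r ∉ π.2}

theorem mem_pendants {π : V × Finset V} :
    π ∈ pendants Γ r ↔ IsComponentOfDelete Γ π.1 ↑π.2 ∧ r ∉ π.2 := by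
  simp [pendants]

variable (R Γ r) in
/-- The combination of the constant families, with coefficients `c.1`, and of the splines attached
to the pendants, with coefficients `c.2`. It parametrizes `coordSplines R Γ`. -/
def combination :
    (V → R) × (∀ π : pendants Γ r, sameCard (marked Γ π.1.1 π.1.2) → R) →ₗ[R]
      (V → Perm V → R) :=
  LinearMap.coprod (LinearMap.pi fun p => LinearMap.pi fun _ => LinearMap.proj p)
    (∑ π, pendantCoords R Γ π.1.1 π.1.2 ∘ₗ extendByZero R _ ∘ₗ LinearMap.proj π)

theorem combination_apply (c : V → R)
    (u : ∀ π : pendants Γ r, sameCard (marked Γ π.1.1 π.1.2) → R) :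
    combination R Γ r (c, u) =
      (fun p _ => c p) + ∑ π, pendantCoords R Γ π.1.1 π.1.2 (extendByZero R _ (u π)) := by
  simp only [combination, LinearMap.coprod_apply, LinearMap.sum_apply]
  rfl

theorem combination_mem (hΓ : Γ.Connected)
    (c : (V → R) × (∀ π : pendants Γ r, sameCard (marked Γ π.1.1 π.1.2) → R)) :
    combination R Γ r c ∈ coordSplines R Γ := by
  rw [combination_apply c.1 c.2]
  exact add_mem (const_mem_coordSplines c.1)
    (sum_mem fun π _ => pendantCoords_mem hΓ (mem_pendants.1 π.2).1 _)

theorem swapDiff_combination (hΓ : Γ.Connected) (c : V → R)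
    {u : ∀ π : pendants Γ r, sameCard (marked Γ π.1.1 π.1.2) → R} (π : pendants Γ r)
    (hu : ∀ π' : pendants Γ r, Γ.dist π'.1.1 r < Γ.dist π.1.1 r → u π' = 0) :
    swapDiff R π.1.1 (neighborIn Γ π.1.1 π.1.2)
        (combination R Γ r (c, u) (neighborIn Γ π.1.1 π.1.2)) =
      swapDiff R π.1.1 (neighborIn Γ π.1.1 π.1.2)
        fun w => extendByZero R _ (u π) (w • marked Γ π.1.1 π.1.2) := by
  have hπ := (mem_pendants.1 π.2).1
  have hconst (x : R) (i j : V) : swapDiff R i j (fun _ => x) = 0 := funext fun _ => sub_self x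
  rw [combination_apply, Pi.add_apply, map_add, hconst, zero_add, Finset.sum_apply, map_sum,
    Finset.sum_eq_single_of_mem π (Finset.mem_univ π), pendantCoords_neighborIn hΓ hπ]
  intro π' _ hne
  obtain ⟨hπ', hr'⟩ := mem_pendants.1 π'.2
  by_cases hi : π.1.1 ∈ π'.1.2
  · rw [hu π' (hπ'.dist_lt hΓ hr' hi), map_zero, map_zero, Pi.zero_apply, map_zero]
  · exact swapDiff_pendantCoords_eq_zero hΓ hπ hπ' hi (fun e => hne (Subtype.ext e)) _

theorem combination_injective (hΓ : Γ.Connected) :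
    Function.Injective (combination R Γ r) := by
  refine (injective_iff_map_eq_zero _).2 fun ⟨c, u⟩ h => ?_
  have hu : ∀ π, u π = 0 := by
    intro π
    induction hd : Γ.dist π.1.1 r using Nat.strong_induction_on generalizing π with
    | _ d ih =>
    have hπ := (mem_pendants.1 π.2).1
    have hdiff := swapDiff_combination hΓ c π fun π' hlt => ih _ (hd ▸ hlt) π' rfl
    rw [h, Pi.zero_apply, map_zero, eq_comm, swapDiff_eq_zero_iff] at hdiff
    exact eq_zero_of_rightInvariance_eq_top (rightInvariance_comp_smul_eq_top
      (notMem_marked hΓ hπ) (neighborIn_mem_marked hΓ hπ) hdiff)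
  obtain rfl : u = 0 := funext hu
  rw [combination_apply] at h
  simp only [Pi.zero_apply, map_zero, Finset.sum_const_zero, add_zero] at h
  exact Prod.ext (funext fun p => congrFun (congrFun h p) 1) rfl

theorem exists_swapDiff_combination_eq (hΓ : Γ.Connected) {a : V → Perm V → R}
    (ha : a ∈ coordSplines R Γ) (d : ℕ) :
    ∃ u, ∀ π : pendants Γ r, Γ.dist π.1.1 r < d →
      swapDiff R π.1.1 (neighborIn Γ π.1.1 π.1.2)
        ((a - combination R Γ r (0, u)) (neighborIn Γ π.1.1 π.1.2)) = 0 := by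
  induction d with
  | zero => exact ⟨0, fun _ h => absurd h (Nat.not_lt_zero _)⟩
  | succ d ih =>
  obtain ⟨u, hu⟩ := ih
  have hb := sub_mem ha (combination_mem hΓ (0, u))
  choose v hv using fun π : pendants Γ r => exists_swapDiff_eq hΓ (mem_pendants.1 π.2).1 hb
  choose v' hv' using fun π : pendants Γ r =>
    exists_extendByZero_smul_eq (marked Γ π.1.1 π.1.2) (v π)
  let u' : ∀ π : pendants Γ r, sameCard (marked Γ π.1.1 π.1.2) → R :=
    fun π => if Γ.dist π.1.1 r = d then v' π else 0
  refine ⟨u + u', fun π hπ => ?_⟩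
  have hsplit : a - combination R Γ r (0, u + u') =
      a - combination R Γ r (0, u) - combination R Γ r (0, u') := by
    rw [sub_sub, ← map_add, Prod.mk_add_mk, add_zero]
  rw [hsplit, Pi.sub_apply, map_sub, swapDiff_combination hΓ 0 π fun π' hlt =>
    if_neg (hlt.trans_le (Nat.le_of_lt_succ hπ)).ne]
  rcases eq_or_ne (Γ.dist π.1.1 r) d with hd | hd
  · simp only [if_pos hd, hv, hv']
    funext w
    simp [swapDiff_apply]
  · rw [hu π (by omega), zero_sub, neg_eq_zero]
    simp only [if_neg hd, map_zero, Pi.zero_apply]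
    exact map_zero _

theorem range_combination (hΓ : Γ.Connected) :
    LinearMap.range (combination R Γ r) = coordSplines R Γ := by
  refine le_antisymm ?_ fun a ha => ?_
  · rintro _ ⟨c, rfl⟩
    exact combination_mem hΓ c
  obtain ⟨u, hu⟩ := exists_swapDiff_combination_eq (r := r) hΓ ha
    (Finset.univ.sup (fun i => Γ.dist i r) + 1)
  set b := a - combination R Γ r (0, u) with hb
  have hconst : ∀ p, rightInvariance (b p) = ⊤ := by
    refine rightInvariance_eq_top (r := r) hΓ (sub_mem ha (combination_mem hΓ (0, u)))
      fun i S hS hr => ?_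
    obtain ⟨hj, hij⟩ := neighborIn_mem_and_adj hΓ hS
    exact ⟨_, hj, hij, hu ⟨(i, S), mem_pendants.2 ⟨hS, hr⟩⟩
      (Nat.lt_succ_of_le (Finset.le_sup (f := fun i => Γ.dist i r) (Finset.mem_univ i)))⟩
  have hb_const : b = combination R Γ r (fun p => b p 1, 0) := by
    rw [combination_apply]
    funext p w
    have hw := mem_rightInvariance.1 (hconst p ▸ Subgroup.mem_top w) 1
    simpa using hw
  refine ⟨(fun p => b p 1, 0) + (0, u), ?_⟩
  rw [map_add, ← hb_const, hb, sub_add_cancel]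

theorem finrank_coordSplines [Nontrivial R] (hΓ : Γ.Connected) (r : V) :
    Module.finrank R (coordSplines R Γ) = Fintype.card V +
      ∑ π ∈ pendants Γ r, ((Fintype.card V).choose (marked Γ π.1 π.2).card - 1) := by
  rw [← range_combination (r := r) hΓ, LinearMap.finrank_range_of_inj (combination_injective hΓ),
    Module.finrank_prod, Module.finrank_pi, Module.finrank_pi_fintype]
  simp only [Module.finrank_pi, Fintype.card_coe, card_sameCard]
  rw [Finset.sum_coe_sort (pendants Γ r)
    fun π => (Fintype.card V).choose (marked Γ π.1 π.2).card - 1]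

end Parametrization

/-! ### Linear splines as families of linear forms -/

section Coordinates

open MvPolynomial Equiv
open scoped Pointwise

section OfCoords

variable {V R : Type*} [Fintype V] [CommRing R] {i j : V}

/-- The family of linear forms whose coefficient of `t_{w(p)}` at `w` is `a p w`. -/
def ofCoords : (V → Perm V → R) →ₗ[R] (Perm V → MvPolynomial V R) where
  toFun a w := ∑ p, a p w • X (w p)
  map_add' a b := by
    funext w
    simp only [Pi.add_apply, add_smul, Finset.sum_add_distrib]
  map_smul' c a := by
    funext w
    simp only [Pi.smul_apply, smul_eq_mul, mul_smul, Finset.smul_sum, RingHom.id_apply]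

theorem ofCoords_apply (a : V → Perm V → R) (w : Perm V) :
    ofCoords a w = ∑ p, a p w • X (w p) :=
  rfl

theorem eval_sum_smul_X (b e : V → R) (w : Perm V) :
    eval (fun k => e (w.symm k)) (∑ p, b p • X (w p)) = ∑ p, b p * e p := by
  simp [map_sum, smul_eval]

theorem ofCoords_injective : Function.Injective (ofCoords (V := V) (R := R)) := by
  classical
  refine (injective_iff_map_eq_zero _).2 fun a ha => funext fun p => funext fun w => ?_
  have h := eval_sum_smul_X (fun p => a p w) (Pi.single p 1) w
  rw [← ofCoords_apply a w, ha] at h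
  simpa [Pi.single_apply] using h.symm

theorem sum_smul_X_mem_span_iff (b : V → R) (w : Perm V) (hij : i ≠ j) :
    ∑ p, b p • X (w p) ∈ Ideal.span {(X (w i) - X (w j) : MvPolynomial V R)} ↔
      (∀ p, p ≠ i → p ≠ j → b p = 0) ∧ ∑ p, b p = 0 := by
  classical
  rw [Ideal.mem_span_singleton]
  constructor
  · rintro ⟨q, hq⟩
    have hsum (e : V → R) (he : e i = e j) : ∑ p, b p * e p = 0 := by
      rw [← eval_sum_smul_X b e w, hq]
      simp [he]
    refine ⟨fun p hpi hpj => ?_, by simpa using hsum 1 rfl⟩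
    simpa [Pi.single_apply] using hsum (Pi.single p 1) (by simp [hpi.symm, hpj.symm])
  · rintro ⟨hb, hsum⟩
    rw [Fintype.sum_eq_add i j hij fun p hp => hb p hp.1 hp.2] at hsum
    refine ⟨C (b i), ?_⟩
    rw [Fintype.sum_eq_add i j hij fun p hp => by rw [hb p hp.1 hp.2, zero_smul],
      eq_neg_of_add_eq_zero_right hsum, smul_eq_C_mul, smul_eq_C_mul, map_neg]
    ring

variable [DecidableEq V]

theorem ofCoords_sub_swap (a : V → Perm V → R) (w : Perm V) (i j : V) :
    ofCoords a w - ofCoords a (w * swap i j) =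
      ∑ p, (a p w - a (swap i j p) (w * swap i j)) • X (w p) := by
  simp only [ofCoords_apply, sub_smul, Finset.sum_sub_distrib, sub_right_inj]
  rw [← Equiv.sum_comp (swap i j)]
  simp only [Perm.mul_apply, swap_apply_self]

theorem ofCoords_cosetCoords (S : Finset V) (u : Finset V → R) (w : Perm V) :
    ofCoords (cosetCoords R i j S u) w = u (w • S) • (X (w j) - X (w i)) := by
  simp [ofCoords_apply, cosetCoords_apply, sub_smul, ite_smul, smul_sub]

theorem ofCoords_cutVertexCoords (S : Finset V) (u : V → R) (w : Perm V) :
    ofCoords (cutVertexCoords R i S u) w = ∑ q ∈ S, u (w q) • (X (w q) - X (w i)) := by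
  simp [ofCoords_apply, cutVertexCoords_apply, sub_smul, ite_smul, smul_sub, Finset.sum_smul]

end OfCoords

variable {n : ℕ} {Γ : SimpleGraph (Fin n)} {i j : Fin n} {S : Finset (Fin n)}

theorem ofCoords_mem_splines_iff {a : Fin n → Perm (Fin n) → ℂ} :
    ofCoords a ∈ splines Γ ↔ a ∈ coordSplines ℂ Γ := by
  have hedge (w : Perm (Fin n)) (i j : Fin n) (hij : Γ.Adj i j) :
      ofCoords a w - ofCoords a (w * swap i j) ∈
          Ideal.span {(X (w i) - X (w j) : MvPolynomial (Fin n) ℂ)} ↔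
        (∀ p, p ≠ i → p ≠ j → a p (w * swap i j) = a p w) ∧
          ∑ p, a p (w * swap i j) = ∑ p, a p w := by
    rw [ofCoords_sub_swap, sum_smul_X_mem_span_iff _ _ hij.ne, Finset.sum_sub_distrib,
      Equiv.sum_comp (swap i j) fun p => a p (w * swap i j), sub_eq_zero,
      eq_comm (a := ∑ p, a p w)]
    refine and_congr_left' (forall₃_congr fun p hi hj => ?_)
    rw [swap_apply_of_ne_of_ne hi hj, sub_eq_zero, eq_comm]
  exact ⟨fun h i j hij w => (hedge w i j hij).1 (h w i j hij),
    fun h w i j hij => (hedge w i j hij).2 (h i j hij w)⟩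

theorem splinesOfDegree_one_eq_map :
    splinesOfDegree Γ 1 = (coordSplines ℂ Γ).map ofCoords := by
  ext ρ
  rw [Submodule.mem_map]
  constructor
  · rintro ⟨hρ, hdeg⟩
    have hlin (w : Perm (Fin n)) : ∃ c : Fin n → ℂ, ∑ k, c k • X k = ρ w := by
      have hw : ρ w ∈ homogeneousSubmodule (Fin n) ℂ 1 := hdeg w (Set.mem_univ w)
      rwa [homogeneousSubmodule_one_eq_span_X, Submodule.mem_span_range_iff_exists_fun] at hw
    choose c hc using hlin
    have heq : ofCoords (fun p w => c w (w p)) = ρ := by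
      funext w
      rw [ofCoords_apply, ← hc w]
      exact Equiv.sum_comp w fun k => c w k • (X k : MvPolynomial (Fin n) ℂ)
    exact ⟨_, ofCoords_mem_splines_iff.1 (by rwa [heq]), heq⟩
  · rintro ⟨a, ha, rfl⟩
    refine ⟨ofCoords_mem_splines_iff.2 ha, fun w _ => ?_⟩
    rw [ofCoords_apply]
    exact Submodule.sum_mem _ fun p _ => Submodule.smul_mem _ _ (isHomogeneous_X _ _)

theorem ofCoords_mem_splinesOfDegree_one {a : Fin n → Perm (Fin n) → ℂ}
    (ha : a ∈ coordSplines ℂ Γ) : ofCoords a ∈ splinesOfDegree Γ 1 := by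
  rw [splinesOfDegree_one_eq_map]
  exact Submodule.mem_map_of_mem ha

theorem finrank_splinesOfDegree_one (hΓ : Γ.Connected) (r : Fin n) :
    Module.finrank ℂ (splinesOfDegree Γ 1) =
      n + ∑ π ∈ pendants Γ r, (n.choose (marked Γ π.1 π.2).card - 1) := by
  rw [splinesOfDegree_one_eq_map,
    ← ((coordSplines ℂ Γ).equivMapOfInjective ofCoords ofCoords_injective).finrank_eq,
    finrank_coordSplines hΓ r, Fintype.card_fin]

theorem xBar_eq_ofCoords (k : Fin n) :
    xBar k = ofCoords (fun p _ => Pi.single (M := fun _ => ℂ) k 1 p) := by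
  funext w
  simp [xBar, ofCoords_apply, Pi.single_apply]

theorem yBar_eq_ofCoords (i : Fin n) (S : Finset (Fin n)) (k : Fin n) :
    yBar i ↑S k = ofCoords (cutVertexCoords ℂ i S (Pi.single k 1)) := by
  funext w
  simp only [yBar, ofCoords_cutVertexCoords, Pi.single_apply, ← Perm.eq_inv_iff_eq, ite_smul,
    one_smul, zero_smul, Finset.sum_ite_eq', Finset.mem_coe]
  split_ifs <;> simp

theorem smul_finset_eq_iff {V : Type*} [DecidableEq V] {S A : Finset V} {w : Perm V} :
    w • S = A ↔ w ⁻¹' (A : Set V) = S := by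
  rw [smul_eq_iff_eq_inv_smul, ← Finset.coe_inj, Finset.coe_smul_finset, ← Set.preimage_smul]
  exact eq_comm

theorem fBar_eq_ofCoords (hΓ : Γ.Connected) (hS : IsComponentOfDelete Γ i ↑S) (hj : j ∈ S)
    (hc : IsCutEdge Γ i j) (A : Finset (Fin n)) :
    fBar Γ j i A = ofCoords (cosetCoords ℂ i j S (Pi.single A 1)) := by
  funext w
  simp only [fBar, hS.cutEdgeComponent_eq hΓ hj hc, ofCoords_cosetCoords, Pi.single_apply,
    smul_finset_eq_iff, ite_smul, one_smul, zero_smul]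

theorem fBar_compl_eq_neg_ofCoords (hΓ : Γ.Connected) (hS : IsComponentOfDelete Γ i ↑S)
    (hj : j ∈ S) (hc : IsCutEdge Γ i j) (A : Finset (Fin n)) :
    fBar Γ i j (↑A)ᶜ = -ofCoords (cosetCoords ℂ i j S (Pi.single A 1)) := by
  funext w
  simp only [fBar, hS.cutEdgeComponent_eq_compl hΓ hj hc, Pi.neg_apply, ofCoords_cosetCoords,
    Pi.single_apply, smul_finset_eq_iff, Set.preimage_compl, compl_inj_iff, ite_smul, one_smul,
    zero_smul, neg_ite, neg_sub, neg_zero]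

theorem tBar_mem_splinesOfDegree_one (k : Fin n) : tBar k ∈ splinesOfDegree Γ 1 :=
  ⟨fun _ _ _ _ => by simp [tBar], fun _ _ => isHomogeneous_X _ _⟩

theorem exists_isComponentOfDelete_mem (hij : i ≠ j) :
    ∃ S : Finset (Fin n), IsComponentOfDelete Γ i ↑S ∧ j ∈ S := by
  obtain ⟨S, hS⟩ := (Set.toFinite (componentOfDelete Γ i j)).exists_finset_coe
  exact ⟨S, hS ▸ isComponentOfDelete_componentOfDelete hij.symm,
    by simpa [← hS] using self_mem_componentOfDelete (Γ := Γ) hij.symm⟩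

theorem span_linearGenerators_le (hΓ : Γ.Connected) :
    Submodule.span ℂ (linearGenerators Γ) ≤ splinesOfDegree Γ 1 := by
  rw [Submodule.span_le]
  rintro ρ (((⟨k, rfl⟩ | ⟨k, rfl⟩) | ⟨i, j, A, -, hc, -, rfl⟩) | ⟨i, G, k, -, hG, rfl⟩)
  · exact tBar_mem_splinesOfDegree_one k
  · rw [xBar_eq_ofCoords]
    exact ofCoords_mem_splinesOfDegree_one (const_mem_coordSplines _)
  · obtain ⟨S, hS, hi⟩ := exists_isComponentOfDelete_mem (Γ := Γ) hc.1.ne'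
    lift A to Finset (Fin n) using Set.toFinite A
    rw [fBar_eq_ofCoords hΓ hS hi (isCutEdge_comm.1 hc)]
    exact ofCoords_mem_splinesOfDegree_one
      (cosetCoords_mem_of_isCutEdge hΓ hS hi (isCutEdge_comm.1 hc) _)
  · lift G to Finset (Fin n) using Set.toFinite G
    rw [yBar_eq_ofCoords]
    exact ofCoords_mem_splinesOfDegree_one (cutVertexCoords_mem hG _)

theorem tBar_mem_span_linearGenerators (k : Fin n) :
    tBar k ∈ Submodule.span ℂ (linearGenerators Γ) :=
  Submodule.subset_span (Or.inl (Or.inl (Or.inl ⟨k, rfl⟩)))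

theorem xBar_mem_span_linearGenerators (k : Fin n) :
    xBar k ∈ Submodule.span ℂ (linearGenerators Γ) :=
  Submodule.subset_span (Or.inl (Or.inl (Or.inr ⟨k, rfl⟩)))

theorem yBar_mem_span_linearGenerators {G : Set (Fin n)} (h : IsComponentOfDelete Γ i G)
    (k : Fin n) : yBar i G k ∈ Submodule.span ℂ (linearGenerators Γ) := by
  by_cases hi : IsCutVertex Γ i
  · exact Submodule.subset_span (Or.inr ⟨i, G, k, hi, h, rfl⟩)
  have hy : yBar i G k = tBar k - xBar i := by
    funext w
    rw [Pi.sub_apply]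
    unfold yBar tBar xBar
    split_ifs with hk
    · rfl
    · have hw : w⁻¹ k = i := by_contra fun hne => hi (h.isCutVertex hk hne)
      rw [← Perm.inv_eq_iff_eq.1 hw, sub_self]
  rw [hy]
  exact sub_mem (tBar_mem_span_linearGenerators k) (xBar_mem_span_linearGenerators i)

theorem ofCoords_cosetCoords_single_mem_span (hΓ : Γ.Connected) (hS : IsComponentOfDelete Γ i ↑S)
    (hj : j ∈ S) (hc : IsCutEdge Γ i j) {A : Finset (Fin n)} (hA : A.card = S.card) :
    ofCoords (cosetCoords ℂ i j S (Pi.single A 1)) ∈ Submodule.span ℂ (linearGenerators Γ) := by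
  rcases lt_or_gt_of_ne hc.1.ne with hij | hij
  · rw [← neg_mem_iff, ← fBar_compl_eq_neg_ofCoords hΓ hS hj hc]
    refine Submodule.subset_span (Or.inl (Or.inr ⟨i, j, _, hij, hc, ?_, rfl⟩))
    rw [hS.cutEdgeComponent_eq_compl hΓ hj hc, Set.ncard_compl, Set.ncard_compl,
      Set.ncard_coe_finset, Set.ncard_coe_finset, hA]
  · rw [← fBar_eq_ofCoords hΓ hS hj hc]
    refine Submodule.subset_span (Or.inl (Or.inr ⟨j, i, _, hij, isCutEdge_comm.1 hc, ?_, rfl⟩))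
    rw [hS.cutEdgeComponent_eq hΓ hj hc, Set.ncard_coe_finset, Set.ncard_coe_finset, hA]

theorem ofCoords_pendantCoords_single_mem_span (hΓ : Γ.Connected)
    (hS : IsComponentOfDelete Γ i ↑S) {A : Finset (Fin n)} (hA : A.card = (marked Γ i S).card) :
    ofCoords (pendantCoords ℂ Γ i S (Pi.single A 1)) ∈
      Submodule.span ℂ (linearGenerators Γ) := by
  unfold marked at hA
  unfold pendantCoords
  split_ifs at hA ⊢ with hc
  · exact ofCoords_cosetCoords_single_mem_span hΓ hS (neighborIn_mem_and_adj hΓ hS).1 hc hA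
  · obtain ⟨k, rfl⟩ := Finset.card_eq_one.1 hA
    have hk : LinearMap.funLeft ℂ ℂ (singleton : Fin n → Finset (Fin n)) (Pi.single {k} 1) =
        (Pi.single k 1 : Fin n → ℂ) := by
      funext x
      simp [LinearMap.funLeft_apply, Pi.single_apply]
    rw [LinearMap.comp_apply, hk, ← yBar_eq_ofCoords]
    exact yBar_mem_span_linearGenerators hS k

theorem span_linearGenerators (hΓ : Γ.Connected) :
    Submodule.span ℂ (linearGenerators Γ) = splinesOfDegree Γ 1 := by
  refine le_antisymm (span_linearGenerators_le hΓ) ?_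
  obtain ⟨r⟩ := hΓ.nonempty
  rw [splinesOfDegree_one_eq_map, ← range_combination (r := r) hΓ]
  rintro _ ⟨_, ⟨⟨c, u⟩, rfl⟩, rfl⟩
  have hconst : ofCoords (fun p (_ : Perm (Fin n)) => c p) = ∑ k, c k • xBar k := by
    funext w
    simp [ofCoords_apply, xBar]
  rw [combination_apply, map_add, map_sum, hconst]
  refine add_mem (sum_mem fun k _ => Submodule.smul_mem _ _ (xBar_mem_span_linearGenerators k))
    (sum_mem fun π _ => ?_)
  rw [extendByZero_eq_sum_single, map_sum, map_sum]
  refine sum_mem fun A _ => ?_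
  rw [map_smul, map_smul]
  exact Submodule.smul_mem _ _ (ofCoords_pendantCoords_single_mem_span hΓ
    (mem_pendants.1 π.2).1 (mem_sameCard.1 A.2).2)

end Coordinates

/-! ### Blocks of cliqued graphs -/

section Blocks

variable {V : Type*} {Γ : SimpleGraph V} {s B : Set V} {v x y z p q : V}

theorem isTwoConnected_of_isClique (hs : s.Nonempty) (h : Γ.IsClique s) :
    IsTwoConnected (Γ.induce s) := by
  have hadj (x y : s) (hxy : x ≠ y) : (Γ.induce s).Adj x y :=
    h x.2 y.2 (Subtype.coe_ne_coe.2 hxy)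
  have := hs.to_subtype
  refine ⟨⟨fun x y => ?_⟩, fun v x y => ?_⟩
  · rcases eq_or_ne x y with rfl | hxy
    · exact Reachable.refl _
    · exact (hadj x y hxy).reachable
  · rcases eq_or_ne x y with rfl | hxy
    · exact Reachable.refl _
    · exact Adj.reachable (hadj x y (Subtype.coe_ne_coe.2 hxy))

theorem IsCliqued.adj_of_reachable_deleteIncidenceSet (hc : IsCliqued Γ) (hxy : Γ.Adj x y)
    (hyz : Γ.Adj y z) (hxz : x ≠ z) (h : (Γ.deleteIncidenceSet y).Reachable x z) :
    Γ.Adj x z := by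
  classical
  obtain ⟨p, hp⟩ := h.exists_isPath
  have hle := Γ.deleteIncidenceSet_le y
  have hy : y ∉ (p.mapLe hle).support := fun hy => by
    rw [Walk.support_mapLe_eq_support] at hy
    exact ne_of_reachable_deleteIncidenceSet (p.takeUntil y hy).reachable hxy.ne rfl
  let q : Γ.Walk x z := Walk.cons hxy (Walk.cons hyz Walk.nil)
  have hq : q.IsPath := by
    simp [q, Walk.cons_isPath_iff, hxy.ne, hyz.ne, hxz]
  refine hc x z hxz ⟨⟨p.mapLe hle, hp.mapLe hle⟩, ⟨q, hq⟩, fun e => hy ?_, fun t ht ht' => ?_⟩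
  · have hpq : p.mapLe hle = q := congrArg Subtype.val e
    simp [hpq, q]
  · have hty : t ≠ y := fun e => hy (e ▸ ht)
    simpa [q, hty] using ht'

theorem IsCliqued.isClique (hc : IsCliqued Γ) (hs : IsTwoConnected (Γ.induce s)) :
    Γ.IsClique s := by
  have eq_or_adj {x z : s} (p : (Γ.induce s).Walk x z) : x = z ∨ Γ.Adj x z := by
    induction p with
    | nil => exact Or.inl rfl
    | @cons x y z hxy p ih =>
      rcases ih with rfl | hyz
      · exact Or.inr hxy
      refine or_iff_not_imp_left.2 fun hxz => ?_
      refine hc.adj_of_reachable_deleteIncidenceSet hxy hyz (Subtype.coe_ne_coe.2 hxz) ?_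
      have hxy' : x ≠ y := hxy.ne
      have hzy : z ≠ y := fun e => hyz.ne (congrArg Subtype.val e.symm)
      let φ : (Γ.induce s).induce {y}ᶜ →g Γ.deleteIncidenceSet (y : V) :=
        { toFun t := t
          map_rel' {a b} hab := Γ.deleteIncidenceSet_adj.2
            ⟨hab, Subtype.coe_ne_coe.2 a.2, Subtype.coe_ne_coe.2 b.2⟩ }
      exact (hs.2 y ⟨x, hxy'⟩ ⟨z, hzy⟩).map φ
  intro x hx z hz hxz
  obtain ⟨p⟩ := hs.1.preconnected ⟨x, hx⟩ ⟨z, hz⟩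
  exact (eq_or_adj p).resolve_left fun e => hxz (congrArg Subtype.val e)

theorem IsBlock.mem_of_adj (hB : IsBlock Γ B) (hc : IsCliqued Γ) (hp : p ∈ B)
    (hpc : ¬ IsCutVertex Γ p) (hpx : Γ.Adj p x) : x ∈ B := by
  have hclique := hc.isClique hB.prop
  have hx (y : V) (hy : y ∈ B) (hxy : x ≠ y) : Γ.Adj x y := by
    rcases eq_or_ne y p with rfl | hyp
    · exact hpx.symm
    refine hc.adj_of_reachable_deleteIncidenceSet hpx.symm (hclique hp hy hyp.symm) hxy ?_
    by_contra hn
    exact hpc (isCutVertex_iff.2 ⟨x, y, hpx.ne', hyp, hn⟩)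
  have hinsert : IsTwoConnected (Γ.induce (insert x B)) :=
    isTwoConnected_of_isClique (Set.insert_nonempty x B) (isClique_insert.2 ⟨hclique, hx⟩)
  exact hB.le_of_ge hinsert (Set.subset_insert x B) (Set.mem_insert x B)

theorem blockCutTree_adj {v : {v : V // IsCutVertex Γ v}} {B : {B : Set V // IsBlock Γ B}} :
    (blockCutTree Γ).Adj (Sum.inl v) (Sum.inr B) ↔ (v : V) ∈ (B : Set V) := by
  simp [blockCutTree, fromRel_adj]

theorem IsLeafBlock.eq_of_mem {B : {B : Set V // IsBlock Γ B}} (hB : IsLeafBlock Γ B)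
    (hp : IsCutVertex Γ p) (hq : IsCutVertex Γ q) (hpB : p ∈ (B : Set V))
    (hqB : q ∈ (B : Set V)) : p = q := by
  obtain ⟨y, hy⟩ := Set.ncard_eq_one.1 hB
  have hsub : ((blockCutTree Γ).neighborSet (Sum.inr B)).Subsingleton :=
    hy ▸ Set.subsingleton_singleton
  simpa using hsub (blockCutTree_adj (v := ⟨p, hp⟩).2 hpB).symm
    (blockCutTree_adj (v := ⟨q, hq⟩).2 hqB).symm

theorem exists_isBlock_of_adj [Finite V] (h : Γ.Adj x y) :
    ∃ B : {B : Set V // IsBlock Γ B}, x ∈ (B : Set V) ∧ y ∈ (B : Set V) := by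
  obtain ⟨B, hB, hmax⟩ := Set.Finite.exists_le_maximal
    (Set.toFinite {s : Set V | IsTwoConnected (Γ.induce s)})
    (isTwoConnected_of_isClique (Set.insert_nonempty x {y}) (isClique_pair.2 fun _ => h))
  exact ⟨⟨B, hmax⟩, hB (Set.mem_insert x {y}), hB (Set.mem_insert_of_mem x rfl)⟩

theorem IsComponentOfDelete.eq_of_isClique {G G' : Set V} (hG : IsComponentOfDelete Γ v G)
    (hG' : IsComponentOfDelete Γ v G') (hs : Γ.IsClique s) (hx : x ∈ G) (hxs : x ∈ s)
    (hy : y ∈ G') (hys : y ∈ s) : G = G' := by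
  rcases eq_or_ne x y with rfl | hxy
  · exact hG.eq_of_mem hG' hx hy
  · exact hG.eq_of_mem hG' (hG.mem_of_adj hx (hs hxs hys hxy) (hG'.ne_of_mem hy)) hy

theorem IsLeafBlock.eq_singleton_of_ncard_le_two [Finite V] {B : {B : Set V // IsBlock Γ B}}
    {G : Set V} (hB : IsLeafBlock Γ B) (hc : IsCliqued Γ) (hcard : (B : Set V).ncard ≤ 2)
    (hv : IsCutVertex Γ v) (hvB : v ∈ (B : Set V)) (hG : IsComponentOfDelete Γ v G) (hx : x ∈ G)
    (hxB : x ∈ (B : Set V)) : G = {x} := by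
  have hxv := hG.ne_of_mem hx
  have hpair : {v, x} = (B : Set V) := Set.eq_of_subset_of_ncard_le
    (Set.insert_subset hvB (Set.singleton_subset_iff.2 hxB)) (by rwa [Set.ncard_pair hxv.symm])
  have hxc : ¬ IsCutVertex Γ x := fun h => hxv (hB.eq_of_mem h hv hxB hvB)
  have hisolated (z : V) (hz : Γ.Adj x z) : z = v := by
    have hzB := B.2.mem_of_adj hc hxB hxc hz
    rw [← hpair] at hzB
    exact hzB.resolve_right hz.ne'
  refine Set.eq_singleton_iff_unique_mem.2 ⟨hx, fun y hy => ?_⟩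
  obtain ⟨p⟩ := (hG.mem_iff hx).1 hy
  cases p with
  | nil => rfl
  | cons hxz _ =>
    obtain ⟨hxz, -, hzv⟩ := Γ.deleteIncidenceSet_adj.1 hxz
    exact absurd (hisolated _ hxz) hzv

theorem subsingleton_isComponentOfDelete_ncard_ne_one [Finite V] (hΓ : Γ.Connected)
    (hc : IsCliqued Γ) (hv : IsCutVertex Γ v)
    (hnonleaf : {B : {B : Set V // IsBlock Γ B} |
      v ∈ (B : Set V) ∧ ¬ IsLeafBlock Γ B}.Subsingleton)
    (hleaf : ∀ B : {B : Set V // IsBlock Γ B}, v ∈ (B : Set V) → IsLeafBlock Γ B →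
      (B : Set V).ncard ≤ 2) :
    {G : Set V | IsComponentOfDelete Γ v G ∧ G.ncard ≠ 1}.Subsingleton := by
  have hblock (G : Set V) (hG : IsComponentOfDelete Γ v G) (hG1 : G.ncard ≠ 1) :
      ∃ B : {B : Set V // IsBlock Γ B}, (v ∈ (B : Set V) ∧ ¬ IsLeafBlock Γ B) ∧
        ∃ x ∈ G, x ∈ (B : Set V) := by
    obtain ⟨x, hx, hvx⟩ := hG.exists_adj hΓ
    obtain ⟨B, hvB, hxB⟩ := exists_isBlock_of_adj hvx
    refine ⟨B, ⟨hvB, fun hB => hG1 ?_⟩, x, hx, hxB⟩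
    rw [hB.eq_singleton_of_ncard_le_two hc (hleaf B hvB hB) hv hvB hG hx hxB,
      Set.ncard_singleton]
  rintro G ⟨hG, hG1⟩ G' ⟨hG', hG1'⟩
  obtain ⟨B, hB, x, hx, hxB⟩ := hblock G hG hG1
  obtain ⟨B', hB', y, hy, hyB⟩ := hblock G' hG' hG1'
  obtain rfl := hnonleaf hB hB'
  exact hG.eq_of_isClique hG' (hc.isClique B.2.prop) hx hxB hy hyB

end Blocks

/-! ### Naturally labelled cliqued graphs -/

section NaturalLabelling

variable {m : ℕ} {Γ : SimpleGraph (Fin (m + 1))} {v : Fin (m + 1)}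

/-- The vertices from `v` on form a clique attached to the rest of the graph at the cut vertex `v`
only, and the labels below `v` decrease with the distance from the last vertex. This is all that
is used of a natural labelling. -/
structure IsEndClique (Γ : SimpleGraph (Fin (m + 1))) (v : Fin (m + 1)) : Prop where
  isCutVertex : IsCutVertex Γ v
  lt_last : v < Fin.last m
  isClique : Γ.IsClique (Set.Ici v)
  not_isCutVertex : ∀ p, v < p → ¬ IsCutVertex Γ p
  le_of_adj : ∀ p x, v < p → Γ.Adj p x → v ≤ x
  lt_of_dist_lt : ∀ j k, j < v → k < v → Γ.dist j (Fin.last m) < Γ.dist k (Fin.last m) → k < j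

theorem Ici_eq_pair (hv : (v : ℕ) + 1 = m) : Set.Ici v = {v, Fin.last m} := by
  ext x
  simp only [Set.mem_Ici, Set.mem_insert_iff, Set.mem_singleton_iff, Fin.le_def, Fin.ext_iff,
    Fin.val_last]
  omega

namespace IsEndClique

theorem adj_last (h : IsEndClique Γ v) {p : Fin (m + 1)} (hp : v ≤ p) (hp' : p ≠ Fin.last m) :
    Γ.Adj p (Fin.last m) :=
  h.isClique hp (Fin.le_last v) hp'

theorem isCutEdge_last (h : IsEndClique Γ v) (hΓ : Γ.Connected) (hv : (v : ℕ) + 1 = m) :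
    IsCutEdge Γ v (Fin.last m) := by
  have hadj := h.adj_last le_rfl h.lt_last.ne
  rw [isCutEdge_comm, (isComponentOfDelete_componentOfDelete hadj.ne).isCutEdge_iff hΓ
    (self_mem_componentOfDelete hadj.ne) hadj.symm]
  intro q _ hq
  have hmem : q ∈ ({v, Fin.last m} : Set (Fin (m + 1))) :=
    Ici_eq_pair hv ▸ h.le_of_adj _ q h.lt_last hq
  exact hmem.resolve_right hq.ne'

theorem isTypeB (h : IsEndClique Γ v) (hB : IsBlock Γ (Set.Ici v)) (hv : (v : ℕ) + 2 = m) :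
    IsTypeB Γ := by
  have hIci : Set.Ici v = {v, ⟨m - 1, by omega⟩, Fin.last m} := by
    ext x
    simp only [Set.mem_Ici, Set.mem_insert_iff, Set.mem_singleton_iff, Fin.le_def, Fin.ext_iff,
      Fin.val_last]
    omega
  exact ⟨v, ⟨m - 1, by omega⟩, hv, by simp only; omega, h.isCutVertex, hIci ▸ hB⟩

theorem isTypeC (h : IsEndClique Γ v) (hv : (v : ℕ) + 2 < m) : IsTypeC Γ := by
  have ha : v < ⟨m - 2, by omega⟩ := Fin.lt_def.2 (by simp only; omega)
  have hb : v < ⟨m - 1, by omega⟩ := Fin.lt_def.2 (by simp only; omega)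
  refine ⟨_, _, by simp only; omega, by simp only; omega, h.not_isCutVertex _ ha,
    h.not_isCutVertex _ hb, h.not_isCutVertex _ h.lt_last, h.isClique.subset ?_⟩
  rintro x (rfl | rfl | rfl)
  exacts [ha.le, hb.le, Fin.le_last v]

theorem val_add_one_eq (h : IsEndClique Γ v) (hΓ : Γ.Connected) (hA : IsTypeA Γ) :
    (v : ℕ) + 1 = m := by
  obtain ⟨a, ha, hcut, -⟩ := hA
  by_contra hne
  have hlt := Fin.lt_def.1 h.lt_last
  rw [Fin.val_last] at hlt
  have hva : v < a := Fin.lt_def.2 (by omega)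
  have hG := isComponentOfDelete_componentOfDelete (Γ := Γ) hcut.1.ne'
  have hlast := self_mem_componentOfDelete (Γ := Γ) hcut.1.ne'
  have hv := hG.mem_of_adj hlast (h.adj_last le_rfl h.lt_last.ne).symm hva.ne
  have hav : Γ.Adj a v := h.isClique hva.le (Set.mem_Ici.2 le_rfl) hva.ne'
  exact h.lt_last.ne ((hG.isCutEdge_iff hΓ hlast hcut.1).1 hcut v hv hav)

theorem val_add_one_lt (h : IsEndClique Γ v) (hB : IsBlock Γ (Set.Ici v))
    (hBC : IsTypeB Γ ∨ IsTypeC Γ) : (v : ℕ) + 1 < m := by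
  have hlt := Fin.lt_def.1 h.lt_last
  rw [Fin.val_last] at hlt
  by_contra hne
  have hvm : (v : ℕ) + 1 = m := by omega
  rcases hBC with ⟨a, b, ha, hb, -, hblock⟩ | ⟨a, b, ha, hb, -, hbc, -⟩
  · obtain rfl : v = b := Fin.ext (by omega)
    have hle := hB.le_of_ge hblock.prop (Ici_eq_pair hvm ▸ Set.subset_insert _ _)
    have hva : v ≤ a := hle (Set.mem_insert _ _)
    rw [Fin.le_def] at hva
    omega
  · obtain rfl : v = b := Fin.ext (by omega)
    exact hbc h.isCutVertex

theorem lt_of_mem (h : IsEndClique Γ v) (hΓ : Γ.Connected) {j x : Fin (m + 1)}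
    {G : Set (Fin (m + 1))} (hG : IsComponentOfDelete Γ j G) (hL : Fin.last m ∉ G)
    (hj : j ≠ Fin.last m) (hx : x ∈ G) : x < v ∧ j ≤ v ∧ x < j := by
  have hjv : j ≤ v := not_lt.1 fun hlt =>
    h.not_isCutVertex j hlt (hG.isCutVertex hL hj.symm)
  have hxv : x < v := not_le.1 fun hle =>
    hL (hG.mem_of_adj hx (h.adj_last hle fun e => hL (e ▸ hx)) hj.symm)
  refine ⟨hxv, hjv, ?_⟩
  rcases hjv.eq_or_lt with rfl | hjv
  · exact hxv
  · exact h.lt_of_dist_lt j x hjv hxv (hG.dist_lt hΓ hL hx)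

end IsEndClique

theorem IsNaturallyLabelled.exists_isEndClique (hn : IsNaturallyLabelled Γ) (hΓ : Γ.Connected)
    (hc : IsCliqued Γ) :
    ∃ v, IsEndClique Γ v ∧ IsBlock Γ (Set.Ici v) ∧ ((v : ℕ) + 1 = m → IsTypeA Γ) := by
  obtain ⟨⟨v, hv⟩, ⟨B, hB⟩, hsub, hvB, hleaf, hmax, -, hne, rfl, -, hdist⟩ := hn
  simp only [blockCutTree_adj] at hsub hvB hmax hne hdist
  have hnc (p : Fin (m + 1)) (hp : v < p) : ¬ IsCutVertex Γ p := fun hpc =>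
    hp.ne' (hleaf.eq_of_mem hpc hv hp.le hvB)
  have hend : IsEndClique Γ v :=
    { isCutVertex := hv
      lt_last := lt_of_le_of_ne (Fin.le_last v) hne.symm
      isClique := hc.isClique hB.prop
      not_isCutVertex := hnc
      le_of_adj p _ hp := hB.mem_of_adj hc hp.le (hnc p hp)
      lt_of_dist_lt j k hj hk := hdist j (not_le.2 hj) k (not_le.2 hk) }
  refine ⟨v, hend, hB, fun hvm => ⟨v, hvm, hend.isCutEdge_last hΓ hvm, ?_⟩⟩
  rw [Ici_eq_pair hvm, Set.ncard_pair hend.lt_last.ne] at hmax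
  exact subsingleton_isComponentOfDelete_ncard_ne_one hΓ hc hv hsub hmax

end NaturalLabelling

/-! ### Counting pendant components -/

section MarkedCard

variable {V W : Type*} {Γ : SimpleGraph V} {i j r x : V} {S : Finset V}

open Classical in
theorem card_marked :
    (marked Γ i S).card = if IsCutEdge Γ i (neighborIn Γ i S) then S.card else 1 := by
  unfold marked
  split_ifs <;> simp

theorem one_le_card_marked (hΓ : Γ.Connected) (hS : IsComponentOfDelete Γ i ↑S) :
    1 ≤ (marked Γ i S).card :=
  Finset.card_pos.2 ⟨_, neighborIn_mem_marked hΓ hS⟩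

theorem card_marked_lt [Fintype V] (hΓ : Γ.Connected) (hS : IsComponentOfDelete Γ i ↑S) :
    (marked Γ i S).card < Fintype.card V :=
  Finset.card_lt_univ_of_notMem (notMem_marked hΓ hS)

theorem isCutEdge_neighborIn_iff (hΓ : Γ.Connected) (hS : IsComponentOfDelete Γ i ↑S) :
    IsCutEdge Γ i (neighborIn Γ i S) ↔
      ∀ p ∈ S, ∀ q ∈ S, Γ.Adj i p → Γ.Adj i q → p = q := by
  obtain ⟨hj, hij⟩ := neighborIn_mem_and_adj hΓ hS
  rw [hS.isCutEdge_iff hΓ hj hij]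
  exact ⟨fun h p hp q hq hip hiq => (h p hp hip).trans (h q hq hiq).symm,
    fun h q hq hiq => h q hq _ hj hiq hij⟩

theorem dist_neighborIn_lt (hΓ : Γ.Connected) (hS : IsComponentOfDelete Γ i ↑S) (hr : r ∉ S)
    (hc : IsCutEdge Γ i (neighborIn Γ i S)) (hx : x ∈ S) (hne : x ≠ neighborIn Γ i S) :
    Γ.dist (neighborIn Γ i S) r < Γ.dist x r := by
  obtain ⟨hj, hij⟩ := neighborIn_mem_and_adj hΓ hS
  refine dist_lt_of_not_reachable_deleteIncidenceSet hΓ hne fun hreach => hr ?_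
  have hclosed : ∀ y z, (Γ.deleteIncidenceSet (neighborIn Γ i S)).Adj y z → y ∈ S → z ∈ S := by
    intro y z hyz hy
    rw [deleteIncidenceSet_adj] at hyz
    refine hS.mem_of_adj hy hyz.1 ?_
    rintro rfl
    exact hyz.2.1 ((hS.isCutEdge_iff hΓ hj hij).1 hc y hy hyz.1.symm)
  exact (iff_of_reachable (P := (· ∈ S))
    (fun y z h => ⟨hclosed y z h, hclosed z y h.symm⟩) hreach).1 hx

theorem card_marked_map {Γ : SimpleGraph W} {f : V ↪ W} (hΓ : Γ.Connected)
    (hΓ' : (Γ.comap f).Connected) (hS : IsComponentOfDelete (Γ.comap f) i ↑S)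
    (hS' : IsComponentOfDelete Γ (f i) ↑(S.map f)) :
    (marked Γ (f i) (S.map f)).card = (marked (Γ.comap f) i S).card := by
  have hc : IsCutEdge Γ (f i) (neighborIn Γ (f i) (S.map f)) ↔
      IsCutEdge (Γ.comap f) i (neighborIn (Γ.comap f) i S) := by
    simp only [isCutEdge_neighborIn_iff hΓ hS', isCutEdge_neighborIn_iff hΓ' hS,
      Finset.forall_mem_map, comap_adj, f.apply_eq_iff_eq]
  rw [card_marked, card_marked, Finset.card_map]
  classical
  exact if_congr hc rfl rfl

variable [Fintype V] [DecidableEq V] [Nontrivial V]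

theorem filter_pendants_root (hr : ¬ IsCutVertex Γ r) :
    (pendants Γ r).filter (fun π => π.1 = r) = {(r, {r}ᶜ)} := by
  have hcomp (x : V) (hx : x ≠ r) : componentOfDelete Γ r x = {r}ᶜ := by
    ext y
    rw [mem_componentOfDelete hx]
    refine ⟨fun h => ne_of_reachable_deleteIncidenceSet h hx, fun hy => ?_⟩
    by_contra h
    exact hr (isCutVertex_iff.2 ⟨x, y, hx, hy, h⟩)
  ext ⟨i, S⟩
  rw [Finset.mem_filter, mem_pendants, Finset.mem_singleton, Prod.mk.injEq]
  constructor
  · rintro ⟨⟨hS, -⟩, rfl⟩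
    obtain ⟨x, hx⟩ := hS.nonempty
    refine ⟨rfl, Finset.coe_injective ?_⟩
    rw [hS.eq_componentOfDelete hx, hcomp x (hS.ne_of_mem hx), Finset.coe_compl,
      Finset.coe_singleton]
  · rintro ⟨rfl, rfl⟩
    obtain ⟨x, hx⟩ := exists_ne i
    refine ⟨⟨isComponentOfDelete_iff.2 ⟨x, hx, ?_⟩, by simp⟩, rfl⟩
    rw [hcomp x hx, Finset.coe_compl, Finset.coe_singleton]

theorem sum_pendants_root (hr : ¬ IsCutVertex Γ r) :
    ∑ π ∈ (pendants Γ r).filter (fun π => π.1 = r),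
      ((Fintype.card V).choose (marked Γ π.1 π.2).card - 1) = Fintype.card V - 1 := by
  have hcard : (marked Γ r {r}ᶜ).card = Fintype.card V - 1 ∨ (marked Γ r {r}ᶜ).card = 1 := by
    rw [card_marked, Finset.card_compl, Finset.card_singleton]
    split_ifs
    exacts [Or.inl rfl, Or.inr rfl]
  rw [filter_pendants_root hr, Finset.sum_singleton]
  rcases hcard with h | h
  · rw [h, Nat.choose_symm Fintype.card_pos, Nat.choose_one_right]
  · rw [h, Nat.choose_one_right]

end MarkedCard

section DominantPairs

variable {m : ℕ} {Γ : SimpleGraph (Fin (m + 1))} {v : Fin (m + 1)}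

open Classical in
theorem strongTerm_add_weakTerm_eq_sum_ite : strongTerm Γ + weakTerm Γ =
    ∑ p : Fin (m + 1) × Fin (m + 1) with IsDominantPair Γ p.1 p.2,
      if IsCutEdge Γ p.1 p.2 then m.choose ((componentOfDelete Γ p.2 p.1).ncard - 1) else 1 := by
  rw [Finset.sum_ite, ← Finset.card_eq_sum_ones, Finset.filter_filter, Finset.filter_filter]
  congr 1
  · rw [strongTerm, ← finsum_mem_coe_finset]
    simp only [IsStronglyDominant, Finset.coe_filter_univ]
  · rw [weakTerm, ← Set.ncard_coe_finset]
    simp only [IsWeaklyDominant, Finset.coe_filter_univ]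

namespace IsEndClique

theorem isDominantPair_iff (h : IsEndClique Γ v) (hΓ : Γ.Connected) {i j : Fin (m + 1)} :
    IsDominantPair Γ i j ↔
      ∃ S, (j, S) ∈ pendants Γ (Fin.last m) ∧ j ≠ Fin.last m ∧ IsGreatest (↑S) i := by
  simp only [mem_pendants]
  constructor
  · rintro ⟨hj, -, G, hG, hL, hi⟩
    lift G to Finset (Fin (m + 1)) using G.toFinite
    exact ⟨G, ⟨hG, hL⟩, fun e => h.not_isCutVertex _ h.lt_last (e ▸ hj), hi⟩
  · rintro ⟨S, ⟨hS, hL⟩, hj, hi⟩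
    exact ⟨hS.isCutVertex hL hj.symm, (h.lt_of_mem hΓ hS hL hj hi.1).2.2, ↑S, hS, hL, hi⟩

theorem isCutEdge_iff (h : IsEndClique Γ v) (hΓ : Γ.Connected) {i j : Fin (m + 1)}
    {S : Finset (Fin (m + 1))} (hS : IsComponentOfDelete Γ j ↑S) (hL : Fin.last m ∉ S)
    (hj : j ≠ Fin.last m) (hi : IsGreatest (↑S) i) :
    IsCutEdge Γ i j ↔ IsCutEdge Γ j (neighborIn Γ j S) := by
  obtain ⟨hk, hjk⟩ := neighborIn_mem_and_adj hΓ hS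
  rw [isCutEdge_comm]
  refine ⟨fun hc => (hS.isCutEdge_iff hΓ hi.1 hc.1).1 hc _ hk hjk ▸ hc, fun hc => ?_⟩
  obtain rfl : i = neighborIn Γ j S := by
    by_contra hne
    have hdist := dist_neighborIn_lt hΓ hS hL hc hi.1 hne
    exact (hi.2 hk).not_gt (h.lt_of_dist_lt _ _ (h.lt_of_mem hΓ hS hL hj hk).1
      (h.lt_of_mem hΓ hS hL hj hi.1).1 hdist)
  exact hc

theorem strongTerm_add_weakTerm (h : IsEndClique Γ v) (hΓ : Γ.Connected) :
    strongTerm Γ + weakTerm Γ = ∑ π ∈ pendants Γ (Fin.last m) with π.1 ≠ Fin.last m,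
      m.choose ((marked Γ π.1 π.2).card - 1) := by
  classical
  have hcomp {j : Fin (m + 1)} {S : Finset (Fin (m + 1))} {i : Fin (m + 1)}
      (hS : (j, S) ∈ pendants Γ (Fin.last m)) (hi : IsGreatest (↑S) i) :
      componentOfDelete Γ j i = ↑S :=
    ((mem_pendants.1 hS).1.eq_componentOfDelete hi.1).symm
  rw [strongTerm_add_weakTerm_eq_sum_ite]
  refine Finset.sum_nbij (fun p => (p.2, (componentOfDelete Γ p.2 p.1).toFinset)) ?_ ?_ ?_ ?_
  · rintro ⟨i, j⟩ hp
    obtain ⟨S, hS, hj, hi⟩ := (h.isDominantPair_iff hΓ).1 (Finset.mem_filter.1 hp).2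
    simpa [hcomp hS hi] using ⟨hS, hj⟩
  · rintro ⟨i, j⟩ hp ⟨i', j'⟩ hp' heq
    obtain ⟨S, hS, -, hi⟩ := (h.isDominantPair_iff hΓ).1 (Finset.mem_filter.1 hp).2
    obtain ⟨S', hS', -, hi'⟩ := (h.isDominantPair_iff hΓ).1 (Finset.mem_filter.1 hp').2
    simp only [hcomp hS hi, hcomp hS' hi', Finset.toFinset_coe, Prod.mk.injEq] at heq
    obtain ⟨rfl, rfl⟩ := heq
    exact Prod.ext (hi.unique hi') rfl
  · rintro ⟨j, S⟩ hπ
    obtain ⟨hS, hj⟩ := Finset.mem_filter.1 hπ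
    have hne : S.Nonempty := (mem_pendants.1 hS).1.nonempty
    have hi := S.isGreatest_max' hne
    refine ⟨(S.max' hne, j), ?_, by simp [hcomp hS hi]⟩
    simpa using (h.isDominantPair_iff hΓ).2 ⟨S, hS, hj, hi⟩
  · rintro ⟨i, j⟩ hp
    obtain ⟨S, hS, hj, hi⟩ := (h.isDominantPair_iff hΓ).1 (Finset.mem_filter.1 hp).2
    obtain ⟨hG, hL⟩ := mem_pendants.1 hS
    simp only [hcomp hS hi, Finset.toFinset_coe, Set.ncard_coe_finset, card_marked,
      ← h.isCutEdge_iff hΓ hG hL hj hi]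
    split_ifs <;> simp

end IsEndClique

end DominantPairs

section SimplicialVertex

variable {V W : Type*} {Γ H : SimpleGraph W} {f : V ↪ W} {u : W} {a i x y : V} {S : Finset V}

theorem reachable_comap_iff (hf : Set.range f = {u}ᶜ) (hu : H.IsClique (H.neighborSet u)) :
    (H.comap f).Reachable x y ↔ H.Reachable (f x) (f y) := by
  refine ⟨fun h => h.map (Embedding.comap f H).toHom, fun h => ?_⟩
  have hfu (z : V) : f z ≠ u := hf.subset ⟨z, rfl⟩
  let P (w : W) : Prop := ∃ z, (H.comap f).Reachable x z ∧ (f z = w ∨ w = u ∧ H.Adj u (f z))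
  have hclosed : ∀ w w', H.Adj w w' → P w → P w' := by
    rintro w w' hadj ⟨z, hz, hzw⟩
    rcases eq_or_ne w' u with rfl | hw'
    · obtain rfl := hzw.resolve_right fun h => hadj.ne h.1
      exact ⟨z, hz, Or.inr ⟨rfl, hadj.symm⟩⟩
    obtain ⟨z', rfl⟩ : w' ∈ Set.range f := hf ▸ hw'
    refine ⟨z', ?_, Or.inl rfl⟩
    rcases hzw with rfl | ⟨rfl, hzw⟩
    · exact hz.trans (Adj.reachable (G := H.comap f) hadj)
    · rcases eq_or_ne z z' with rfl | hne
      · exact hz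
      · exact hz.trans (Adj.reachable (G := H.comap f) (hu hzw hadj (f.injective.ne hne)))
  obtain ⟨z, hz, hzy⟩ := (iff_of_reachable (P := P)
    (fun w w' h => ⟨hclosed w w' h, hclosed w' w h.symm⟩) h).1 ⟨x, Reachable.refl x, Or.inl rfl⟩
  rwa [← f.injective (hzy.resolve_right fun h => hfu y h.1)]

theorem reachable_deleteIncidenceSet_comap_iff (hf : Set.range f = {u}ᶜ)
    (hu : Γ.IsClique (Γ.neighborSet u)) :
    ((Γ.comap f).deleteIncidenceSet i).Reachable x y ↔
      (Γ.deleteIncidenceSet (f i)).Reachable (f x) (f y) := by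
  have hcomap : (Γ.comap f).deleteIncidenceSet i = (Γ.deleteIncidenceSet (f i)).comap f := by
    ext x y
    simp only [deleteIncidenceSet_adj, comap_adj, f.injective.ne_iff]
  rw [hcomap, reachable_comap_iff hf]
  intro p hp q hq hpq
  rw [mem_neighborSet, deleteIncidenceSet_adj] at hp hq
  exact Γ.deleteIncidenceSet_adj.2 ⟨hu hp.1 hq.1 hpq, hp.2.2, hq.2.2⟩

theorem IsComponentOfDelete.map (hf : Set.range f = {u}ᶜ) (hu : Γ.IsClique (Γ.neighborSet u))
    (h : IsComponentOfDelete (Γ.comap f) i ↑S) (hS : ∀ x ∈ S, ¬ Γ.Adj u (f x)) :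
    IsComponentOfDelete Γ (f i) ↑(S.map f) := by
  obtain ⟨x, hx⟩ := h.nonempty
  have hxi : f x ≠ f i := f.injective.ne (h.ne_of_mem hx)
  have hclosed : ∀ w w', (Γ.deleteIncidenceSet (f i)).Adj w w' → w ∈ S.map f → w' ∈ S.map f := by
    intro w w' hww hw
    obtain ⟨y, hy, rfl⟩ := Finset.mem_map.1 hw
    obtain ⟨hadj, -, hw'⟩ := Γ.deleteIncidenceSet_adj.1 hww
    obtain ⟨z, rfl⟩ : w' ∈ Set.range f := hf ▸ fun e => hS y hy (e ▸ hadj.symm)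
    exact Finset.mem_map_of_mem f (h.mem_of_adj hy hadj fun e => hw' (congrArg f e))
  refine isComponentOfDelete_iff.2 ⟨f x, hxi, Set.ext fun w => ?_⟩
  rw [mem_componentOfDelete hxi, Finset.mem_coe]
  constructor
  · intro hw
    obtain ⟨y, hy, rfl⟩ := Finset.mem_map.1 hw
    exact (reachable_deleteIncidenceSet_comap_iff hf hu).1 ((h.mem_iff hx).1 hy)
  · exact fun hw => (iff_of_reachable (P := (· ∈ S.map f))
      (fun y z hyz => ⟨hclosed y z hyz, hclosed z y hyz.symm⟩) hw).1 (Finset.mem_map_of_mem f hx)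

theorem isComponentOfDelete_map_iff (hf : Set.range f = {u}ᶜ)
    (hu : Γ.IsClique (Γ.neighborSet u)) :
    IsComponentOfDelete Γ (f i) ↑(S.map f) ↔
      IsComponentOfDelete (Γ.comap f) i ↑S ∧ ∀ x ∈ S, ¬ Γ.Adj u (f x) := by
  have hfu (z : V) : f z ≠ u := hf.subset ⟨z, rfl⟩
  refine ⟨fun h => ⟨?_, fun x hx hux => ?_⟩, fun h => h.1.map hf hu h.2⟩
  · obtain ⟨w, hw⟩ := h.nonempty
    obtain ⟨x, -, rfl⟩ := Finset.mem_map.1 hw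
    have hxi : x ≠ i := fun e => h.ne_of_mem hw (congrArg f e)
    refine isComponentOfDelete_iff.2 ⟨x, hxi, Set.ext fun y => ?_⟩
    rw [mem_componentOfDelete hxi, reachable_deleteIncidenceSet_comap_iff hf hu, ← h.mem_iff hw,
      Finset.mem_coe, Finset.mem_coe, Finset.mem_map' f]
  · obtain ⟨z, -, hz⟩ := Finset.mem_map.1
      (h.mem_of_adj (Finset.mem_coe.2 (Finset.mem_map_of_mem f hx)) hux.symm (hfu i).symm)
    exact hfu z hz

theorem connected_comap [Nonempty V] (hf : Set.range f = {u}ᶜ)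
    (hu : Γ.IsClique (Γ.neighborSet u)) (hΓ : Γ.Connected) : (Γ.comap f).Connected :=
  ⟨fun _ _ => (reachable_comap_iff hf hu).2 (hΓ.preconnected _ _)⟩

variable [Fintype V] [Fintype W] [DecidableEq V] [DecidableEq W]

theorem map_mem_pendants_iff (hf : Set.range f = {u}ᶜ) (hu : Γ.IsClique (Γ.neighborSet u))
    (ha : Γ.Adj u (f a)) (hi : i = a → ∀ x, Γ.Adj u (f x) → x = a) :
    (f i, S.map f) ∈ pendants Γ u ↔ (i, S) ∈ pendants (Γ.comap f) a := by
  have huS : u ∉ S.map f := fun h => by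
    obtain ⟨z, -, hz⟩ := Finset.mem_map.1 h
    exact hf.subset ⟨z, rfl⟩ hz
  simp only [mem_pendants, isComponentOfDelete_map_iff hf hu, huS, not_false_eq_true, and_true]
  refine and_congr_right fun hS => ⟨fun h haS => h a haS ha, fun haS x hx hux => haS ?_⟩
  rcases eq_or_ne x a with rfl | hxa
  · exact hx
  · refine hS.mem_of_adj hx (hu hux ha (f.injective.ne hxa)) ?_
    rintro rfl
    exact hxa (hi rfl x hux)

theorem sum_pendants_comap (hf : Set.range f = {u}ᶜ) (hu : Γ.IsClique (Γ.neighborSet u))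
    (hΓ : Γ.Connected) (ha : Γ.Adj u (f a)) (Q : Finset V)
    (hQ : a ∈ Q → ∀ x, Γ.Adj u (f x) → x = a) (F : ℕ → ℕ) :
    ∑ π ∈ pendants Γ u with π.1 ∈ Q.map f, F (marked Γ π.1 π.2).card =
      ∑ π ∈ pendants (Γ.comap f) a with π.1 ∈ Q, F (marked (Γ.comap f) π.1 π.2).card := by
  have : Nonempty V := ⟨a⟩
  symm
  refine Finset.sum_nbij (fun π => (f π.1, π.2.map f)) ?_ ?_ ?_ ?_
  · rintro ⟨i, S⟩ hπ
    obtain ⟨hS, hi⟩ := Finset.mem_filter.1 hπ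
    exact Finset.mem_filter.2 ⟨(map_mem_pendants_iff hf hu ha fun e => hQ (e ▸ hi)).2 hS,
      Finset.mem_map_of_mem f hi⟩
  · rintro π - π' - heq
    rw [Prod.mk.injEq] at heq
    exact Prod.ext (f.injective heq.1) (Finset.map_injective f heq.2)
  · rintro ⟨j, T⟩ hπ
    obtain ⟨hT, hj⟩ := Finset.mem_filter.1 hπ
    obtain ⟨i, hi, rfl⟩ := Finset.mem_map.1 hj
    obtain ⟨S, rfl⟩ : ∃ S : Finset V, S.map f = T := by
      have hrange : (T : Set W) ⊆ f '' Set.univ := fun w hw =>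
        Set.image_univ.symm ▸ hf ▸ fun e => (mem_pendants.1 hT).2 (e ▸ hw)
      obtain ⟨S, -, hS⟩ := Finset.subset_set_image_iff.1 hrange
      exact ⟨S, (Finset.map_eq_image f S).trans hS⟩
    exact ⟨(i, S), Finset.mem_filter.2
      ⟨(map_mem_pendants_iff hf hu ha fun e => hQ (e ▸ hi)).1 hT, hi⟩, rfl⟩
  · rintro ⟨i, S⟩ hπ
    obtain ⟨hS, hi⟩ := Finset.mem_filter.1 hπ
    have hS' := (map_mem_pendants_iff hf hu ha fun e => hQ (e ▸ hi)).2 hS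
    rw [card_marked_map hΓ (connected_comap hf hu hΓ) (mem_pendants.1 hS).1
      (mem_pendants.1 hS').1]

end SimplicialVertex

/-! ### The recursion for the dimension -/

section Recursion

variable {m : ℕ} {Γ : SimpleGraph (Fin (m + 1))} {v : Fin (m + 1)}

theorem choose_succ_sub_one {n c : ℕ} (hc : 1 ≤ c) (hcn : c ≤ n) :
    (n + 1).choose c - 1 = n.choose (c - 1) + (n.choose c - 1) := by
  obtain ⟨c, rfl⟩ := Nat.exists_eq_add_of_le' hc
  rw [Nat.choose_succ_succ', Nat.add_sub_cancel, Nat.add_sub_assoc (Nat.choose_pos hcn)]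

theorem range_castSuccEmb : Set.range (Fin.castSuccEmb (n := m)) = {Fin.last m}ᶜ :=
  Set.ext fun _ => Fin.exists_castSucc_eq

namespace IsEndClique

theorem isClique_neighborSet_last (h : IsEndClique Γ v) :
    Γ.IsClique (Γ.neighborSet (Fin.last m)) :=
  h.isClique.subset fun x hx => h.le_of_adj _ x h.lt_last hx

theorem finrank_eq (h : IsEndClique Γ v) (hΓ : Γ.Connected) :
    Module.finrank ℂ (splinesOfDegree Γ 1) = (m + 1) + m + (strongTerm Γ + weakTerm Γ) +
      ∑ π ∈ pendants Γ (Fin.last m) with π.1 ≠ Fin.last m,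
        (m.choose (marked Γ π.1 π.2).card - 1) := by
  have : Nontrivial (Fin (m + 1)) := ⟨v, _, h.lt_last.ne⟩
  have hroot := sum_pendants_root (h.not_isCutVertex _ h.lt_last)
  rw [Fintype.card_fin, Nat.add_sub_cancel] at hroot
  have hPascal : ∑ π ∈ pendants Γ (Fin.last m) with π.1 ≠ Fin.last m,
      ((m + 1).choose (marked Γ π.1 π.2).card - 1) = strongTerm Γ + weakTerm Γ +
        ∑ π ∈ pendants Γ (Fin.last m) with π.1 ≠ Fin.last m,
          (m.choose (marked Γ π.1 π.2).card - 1) := by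
    rw [h.strongTerm_add_weakTerm hΓ, ← Finset.sum_add_distrib]
    refine Finset.sum_congr rfl fun π hπ => ?_
    have hS := (mem_pendants.1 (Finset.mem_filter.1 hπ).1).1
    have hlt := card_marked_lt hΓ hS
    rw [Fintype.card_fin] at hlt
    exact choose_succ_sub_one (one_le_card_marked hΓ hS) (Nat.lt_succ_iff.1 hlt)
  rw [finrank_splinesOfDegree_one hΓ (Fin.last m),
    ← Finset.sum_filter_add_sum_filter_not _ (fun π => π.1 = Fin.last m), hroot, hPascal]
  ring

theorem sum_pendants_deleteLast (h : IsEndClique Γ v) (hΓ : Γ.Connected) {a : Fin m}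
    (ha : Γ.Adj (Fin.last m) a.castSucc) (Q : Finset (Fin m))
    (hQ : a ∈ Q → ∀ x : Fin m, Γ.Adj (Fin.last m) x.castSucc → x = a)
    (hQ' : ∀ π ∈ pendants Γ (Fin.last m), π.1 ≠ Fin.last m → π.1 ∈ Q.map Fin.castSuccEmb) :
    ∑ π ∈ pendants Γ (Fin.last m) with π.1 ≠ Fin.last m, (m.choose (marked Γ π.1 π.2).card - 1) =
      ∑ π ∈ pendants (deleteLast Γ) a with π.1 ∈ Q,
        (m.choose (marked (deleteLast Γ) π.1 π.2).card - 1) := by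
  have hfilter : {π ∈ pendants Γ (Fin.last m) | π.1 ≠ Fin.last m} =
      {π ∈ pendants Γ (Fin.last m) | π.1 ∈ Q.map Fin.castSuccEmb} := by
    refine Finset.filter_congr fun π hπ => ⟨hQ' π hπ, fun hmem => ?_⟩
    obtain ⟨i, -, hi⟩ := Finset.mem_map.1 hmem
    exact hi ▸ (Fin.castSucc_lt_last i).ne
  rw [hfilter]
  exact sum_pendants_comap range_castSuccEmb h.isClique_neighborSet_last hΓ ha Q hQ
    (fun c => m.choose c - 1)

theorem connected_deleteLast (h : IsEndClique Γ v) (hΓ : Γ.Connected) :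
    (deleteLast Γ).Connected :=
  have : Nonempty (Fin m) := (Fin.exists_castSucc_eq.2 h.lt_last.ne).nonempty
  connected_comap range_castSuccEmb h.isClique_neighborSet_last hΓ

theorem finrank_eq_of_val_add_one_eq (h : IsEndClique Γ v) (hΓ : Γ.Connected)
    (hv : (v : ℕ) + 1 = m) :
    Module.finrank ℂ (splinesOfDegree Γ 1) =
      1 + Module.finrank ℂ (splinesOfDegree (deleteLast Γ) 1) + m.choose 1 + strongTerm Γ +
        weakTerm Γ := by
  obtain ⟨a, rfl⟩ := Fin.exists_castSucc_eq.2 h.lt_last.ne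
  have honly (x : Fin m) (hx : Γ.Adj (Fin.last m) x.castSucc) : x = a := by
    have hmem : x.castSucc ∈ ({a.castSucc, Fin.last m} : Set (Fin (m + 1))) :=
      Ici_eq_pair hv ▸ h.le_of_adj _ _ h.lt_last hx
    exact Fin.castSucc_injective m (hmem.resolve_right hx.ne')
  have hsum := h.sum_pendants_deleteLast hΓ (h.adj_last le_rfl h.lt_last.ne).symm Finset.univ
    (fun _ => honly) fun π _ hπ => by simpa [Fin.exists_castSucc_eq] using hπ
  simp only [Finset.mem_univ, Finset.filter_true] at hsum
  rw [h.finrank_eq hΓ, hsum, finrank_splinesOfDegree_one (h.connected_deleteLast hΓ) a,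
    Nat.choose_one_right]
  ring

theorem not_isCutVertex_deleteLast (h : IsEndClique Γ v) {a : Fin m} (ha : v < a.castSucc) :
    ¬ IsCutVertex (deleteLast Γ) a := by
  intro hcut
  obtain ⟨x, y, hx, hy, hxy⟩ := isCutVertex_iff.1 hcut
  refine h.not_isCutVertex _ ha (isCutVertex_iff.2 ⟨x.castSucc, y.castSucc, ?_, ?_, ?_⟩)
  · exact (Fin.castSucc_injective m).ne hx
  · exact (Fin.castSucc_injective m).ne hy
  · exact mt (reachable_deleteIncidenceSet_comap_iff range_castSuccEmb
      h.isClique_neighborSet_last).2 hxy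

theorem finrank_eq_of_val_add_one_lt (h : IsEndClique Γ v) (hΓ : Γ.Connected)
    (hv : (v : ℕ) + 1 < m) :
    Module.finrank ℂ (splinesOfDegree Γ 1) =
      1 + Module.finrank ℂ (splinesOfDegree (deleteLast Γ) 1) + 1 + strongTerm Γ +
        weakTerm Γ := by
  let a : Fin m := ⟨m - 1, by omega⟩
  have hva : v < a.castSucc := Fin.lt_def.2 (by simp only [a, Fin.val_castSucc]; omega)
  have : Nontrivial (Fin m) := Fin.nontrivial_iff_two_le.2 (by omega)
  have hsum := h.sum_pendants_deleteLast hΓ (h.adj_last hva.le (Fin.castSucc_lt_last a).ne).symm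
    {a}ᶜ (fun ha => absurd ha (by simp)) fun π hπ hne => by
      obtain ⟨i, hi⟩ := Fin.exists_castSucc_eq.2 hne
      obtain ⟨hS, hL⟩ := mem_pendants.1 hπ
      refine Finset.mem_map.2 ⟨i, ?_, hi⟩
      rw [Finset.mem_compl, Finset.mem_singleton]
      rintro rfl
      exact h.not_isCutVertex _ hva (hi ▸ hS.isCutVertex hL hne.symm)
  have hroot := sum_pendants_root (h.not_isCutVertex_deleteLast hva)
  have hsplit := Finset.sum_filter_add_sum_filter_not (pendants (deleteLast Γ) a)
    (fun π => π.1 = a) (fun π => m.choose (marked (deleteLast Γ) π.1 π.2).card - 1)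
  simp only [Fintype.card_fin, Finset.mem_compl, Finset.mem_singleton] at hroot hsum
  rw [h.finrank_eq hΓ, hsum, finrank_splinesOfDegree_one (h.connected_deleteLast hΓ) a, ← hsplit,
    hroot]
  omega

end IsEndClique

end Recursion

end CayleySplines

end

theorem mainTheorem5 (m : ℕ) (Γ : SimpleGraph (Fin (m + 1))) (hΓ : Γ.Connected) :
    Submodule.span ℂ (CayleySplines.linearGenerators Γ) = CayleySplines.splinesOfDegree Γ 1 ∧
    (CayleySplines.IsCliqued Γ → CayleySplines.IsNaturallyLabelled Γ →
      (CayleySplines.IsTypeA Γ ∨ CayleySplines.IsTypeB Γ ∨ CayleySplines.IsTypeC Γ) ∧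
      (CayleySplines.IsTypeA Γ →
        Module.finrank ℂ (CayleySplines.splinesOfDegree Γ 1) =
          1 + Module.finrank ℂ
              (CayleySplines.splinesOfDegree (CayleySplines.deleteLast Γ) 1) +
            m.choose 1 + CayleySplines.strongTerm Γ + CayleySplines.weakTerm Γ) ∧
      (CayleySplines.IsTypeB Γ ∨ CayleySplines.IsTypeC Γ →
        Module.finrank ℂ (CayleySplines.splinesOfDegree Γ 1) =
          1 + Module.finrank ℂ
              (CayleySplines.splinesOfDegree (CayleySplines.deleteLast Γ) 1) +
            1 + CayleySplines.strongTerm Γ + CayleySplines.weakTerm Γ)) := by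
  refine ⟨CayleySplines.span_linearGenerators hΓ, fun hc hn => ?_⟩
  obtain ⟨v, hv, hB, hA⟩ := hn.exists_isEndClique hΓ hc
  refine ⟨?_, fun h => hv.finrank_eq_of_val_add_one_eq hΓ (hv.val_add_one_eq hΓ h),
    fun h => hv.finrank_eq_of_val_add_one_lt hΓ (hv.val_add_one_lt hB h)⟩
  have hlt : (v : ℕ) < m := hv.lt_last
  rcases (show (v : ℕ) + 1 = m ∨ (v : ℕ) + 2 = m ∨ (v : ℕ) + 2 < m by omega) with h | h | h
  · exact Or.inl (hA h)
  · exact Or.inr (Or.inl (hv.isTypeB hB h))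
  · exact Or.inr (Or.inr (hv.isTypeC h))
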